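/- Let $F$ be a field (of any characteristic, finite or infinite). By an $F$-algebra we mean a unital, not necessarily associative algebra over $F$. With $(x,y,z)=(xy)z-x(yz)$, the nucleus of $A$ is $N(A)=\{x\in A : (x,A,A)=(A,x,A)=(A,A,x)=0\}$, an associative algebra; the center of $A$ is the set of elements of $N(A)$ commuting with all of $A$; and $A$ is $F$-central if $A\neq 0$ and its center is $F\cdot 1$. An étale $F$-algebra is a finite direct product of finite separable field extensions of $F$. A module is minimally faithful if it is faithful and no section of it (quotient $Q/P$ of submodules $P\subseteq Q$), other than the module itself, is faithful. An $F$-algebra $A$ is semiassociative if it is finite dimensional, $F$-central, and there is an étale (unital) $F$-subalgebra $K\subseteq N(A)$ such that $A$ is minimally faithful as a module over $K\otimes_F K$ via $(k\otimes k')a=kak'$. For $n\ge 1$ and scalars $c_{ijk}\in F$ $(1\le i,j,k\le n)$ with $c_{iij}=c_{jii}=1$ for all $i,j$, the skew matrix algebra $M_n(F;c)$ is the $F$-algebra with basis $e_{ij}$ $(1\le i,j\le n)$ and multiplication $e_{ij}e_{k\ell}=\delta_{jk}c_{ij\ell}e_{i\ell}$. A field extension $E/F$, algebraic or not, is called separable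 if $\overline F\otimes_F E$ is reduced, where $\overline F$ is an algebraic closure of $F$; for algebraic extensions this is the usual notion. Let $A$ be an $F$-algebra. 1. If $E\otimes_F A$ is a semiassociative $E$-algebra for some separable field extension $E/F$, then $A$ is a semiassociative $F$-algebra. 2. $A$ is semiassociative if and only if it is a form of skew matrices, that is, there is a separable field extension $E/F$ such that $E\otimes_F A$ is isomorphic, as an $E$-algebra, to a skew matrix algebra $M_n(E;c)$ for some $n\geq 1$ and some $c$ as above. This equivalence also holds with "separable field extension" replaced by "separable algebraic field extension", and with it replaced by "finite separable field extension". -/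

import Mathlib

open scoped TensorProduct

universe u v w

/-! A (unital, not necessarily associative) algebra `A` over a field `F` is given by
`[NonAssocRing A] [Module F A] [SMulCommClass F A A] [IsScalarTower F A A]`. -/

namespace Semiassoc

section Nucleus

variable (F : Type u) [Field F] (A : Type v) [NonAssocRing A] [Module F A]
  [SMulCommClass F A A] [IsScalarTower F A A]

/-- The nucleus of `A`: the intersection of the left, middle and right nuclei. -/
def nucleus : Submodule F A where
  carrier := {x | (∀ a b : A, associator x a b = 0) ∧ (∀ a b : A, associator a x b = 0) ∧
    (∀ a b : A, associator a b x = 0)}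
  zero_mem' := by simp [associator]
  add_mem' := by
    rintro x y ⟨hx₁, hx₂, hx₃⟩ ⟨hy₁, hy₂, hy₃⟩
    simp only [associator, sub_eq_zero] at *
    refine ⟨fun a b => ?_, fun a b => ?_, fun a b => ?_⟩
    · simp only [add_mul, hx₁, hy₁]
    · simp only [add_mul, mul_add, hx₂, hy₂]
    · simp only [mul_add, hx₃, hy₃]
  smul_mem' := by
    rintro r x ⟨hx₁, hx₂, hx₃⟩
    simp only [associator, sub_eq_zero] at *
    refine ⟨fun a b => ?_, fun a b => ?_, fun a b => ?_⟩
    · simp only [smul_mul_assoc, hx₁]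
    · simp only [smul_mul_assoc, mul_smul_comm, hx₂]
    · simp only [mul_smul_comm, hx₃]

variable {F A}

theorem mem_nucleus_iff {x : A} : x ∈ nucleus F A ↔
    (∀ a b : A, (x * a) * b = x * (a * b)) ∧ (∀ a b : A, (a * x) * b = a * (x * b)) ∧
    (∀ a b : A, (a * b) * x = a * (b * x)) := by
  simp only [← sub_eq_zero (b := _ * (_ * _))]
  exact Iff.rfl

theorem nucleus_left (x : nucleus F A) (a b : A) : ((x : A) * a) * b = x * (a * b) :=
  (mem_nucleus_iff.1 x.2).1 a b

theorem nucleus_mid (x : nucleus F A) (a b : A) : (a * (x : A)) * b = a * (x * b) :=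
  (mem_nucleus_iff.1 x.2).2.1 a b

theorem nucleus_right (x : nucleus F A) (a b : A) : (a * b) * (x : A) = a * (b * x) :=
  (mem_nucleus_iff.1 x.2).2.2 a b

theorem one_mem_nucleus : (1 : A) ∈ nucleus F A := by
  rw [mem_nucleus_iff]; simp

theorem mul_mem_nucleus {x y : A} (hx : x ∈ nucleus F A) (hy : y ∈ nucleus F A) :
    x * y ∈ nucleus F A := by
  rw [mem_nucleus_iff] at *
  obtain ⟨hx₁, hx₂, hx₃⟩ := hx
  obtain ⟨hy₁, hy₂, hy₃⟩ := hy
  refine ⟨fun a b => ?_, fun a b => ?_, fun a b => ?_⟩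
  · rw [hx₁, hx₁, hx₁, hy₁]
  · rw [← hx₂, hy₂, hx₂, hx₁]
  · rw [← hx₂, ← hx₂, ← hy₃, hx₃]

instance : Mul (nucleus F A) := ⟨fun x y => ⟨x * y, mul_mem_nucleus x.2 y.2⟩⟩

instance : One (nucleus F A) := ⟨⟨1, one_mem_nucleus⟩⟩

theorem nucleus_coe_mul (x y : nucleus F A) : ((x * y : nucleus F A) : A) = x * y := rfl

theorem nucleus_coe_one : ((1 : nucleus F A) : A) = 1 := rfl

/-- The nucleus is an associative ring under the operations of `A`. -/
instance : Ring (nucleus F A) :=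
  { (inferInstance : AddCommGroup (nucleus F A)),
    (inferInstance : Mul (nucleus F A)), (inferInstance : One (nucleus F A)) with
    left_distrib := fun x y z => Subtype.ext (mul_add (x : A) y z)
    right_distrib := fun x y z => Subtype.ext (add_mul (x : A) y z)
    zero_mul := fun x => Subtype.ext (zero_mul (x : A))
    mul_zero := fun x => Subtype.ext (mul_zero (x : A))
    mul_assoc := fun x y z => Subtype.ext (nucleus_left x (y : A) z)
    one_mul := fun x => Subtype.ext (one_mul (x : A))
    mul_one := fun x => Subtype.ext (mul_one (x : A)) }

/-- The nucleus is an associative `F`-algebra, with the scalar action inherited from `A`. -/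
instance : Algebra F (nucleus F A) :=
  Algebra.ofModule (fun r x y => Subtype.ext (smul_mul_assoc r (x : A) y))
    (fun r x y => Subtype.ext (mul_smul_comm r (x : A) y))

end Nucleus

section BiAction

variable {F : Type u} [Field F] {A : Type v} [NonAssocRing A] [Module F A]
  [SMulCommClass F A A] [IsScalarTower F A A]

/-- Left multiplication by elements of a subalgebra of the nucleus. -/
def leftAction (K : Subalgebra F (nucleus F A)) : K →ₐ[F] Module.End F A :=
  AlgHom.ofLinearMap
    ((LinearMap.mul F A) ∘ₗ (nucleus F A).subtype ∘ₗ K.val.toLinearMap)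
    (LinearMap.ext fun a => one_mul a)
    (fun x _ => LinearMap.ext fun a => nucleus_left (x : nucleus F A) _ a)

/-- Right multiplication by elements of a commutative subalgebra of the nucleus. -/
def rightAction (K : Subalgebra F (nucleus F A)) [IsMulCommutative K] :
    K →ₐ[F] Module.End F A :=
  AlgHom.ofLinearMap
    ((LinearMap.mul F A).flip ∘ₗ (nucleus F A).subtype ∘ₗ K.val.toLinearMap)
    (LinearMap.ext fun a => mul_one a)
    (fun x y => LinearMap.ext fun a => by
      have h : x * y = y * x := mul_comm' x y
      rw [h]
      exact (nucleus_right (x : nucleus F A) a ((y : nucleus F A) : A)).symm)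

open scoped IsMulCommutative in
/-- The action of `K ⊗ K` on `A` given by `(k ⊗ k') a = k a k'`, for a commutative subalgebra `K`
of the nucleus of `A`. -/
noncomputable def biAction (K : Subalgebra F (nucleus F A)) [IsMulCommutative K] :
    K ⊗[F] K →ₐ[F] Module.End F A :=
  Algebra.TensorProduct.lift (leftAction K) (rightAction K)
    (fun x _ => LinearMap.ext fun a => (nucleus_left (x : nucleus F A) a _).symm)

theorem biAction_tmul (K : Subalgebra F (nucleus F A)) [IsMulCommutative K] (k k' : K) (a : A) :
    biAction K (k ⊗ₜ[F] k') a = ((k : nucleus F A) : A) * a * ((k' : nucleus F A) : A) :=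
  (nucleus_left (k : nucleus F A) a _).symm

end BiAction

/-- A module is minimally faithful if it is faithful and none of its sections (quotients `Q / P`
of submodules `P ≤ Q`), other than the module itself, is faithful. -/
def IsMinimallyFaithful (R : Type u) (M : Type v) [Ring R] [AddCommGroup M] [Module R M] : Prop :=
  FaithfulSMul R M ∧
    ∀ P Q : Submodule R M, P ≤ Q → FaithfulSMul R (Q ⧸ P.submoduleOf Q) → P = ⊥ ∧ Q = ⊤

section Semiassociative

variable (F : Type u) [Field F] (A : Type v) [NonAssocRing A] [Module F A]
  [SMulCommClass F A A] [IsScalarTower F A A]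

/-- `A` is `F`-central: `F` embeds in `A`, and its image is the whole center of `A`
(the elements that associate and commute with everything). -/
def IsCentralAlgebra : Prop :=
  Nontrivial A ∧ Set.center A = Set.range (fun r : F => r • (1 : A))

open scoped IsMulCommutative in
/-- `A` is semiassociative: it is finite dimensional, `F`-central, and minimally faithful over
`K ⊗ K` for some étale `F`-subalgebra `K` of its nucleus. -/
def IsSemiassociative : Prop :=
  FiniteDimensional F A ∧ IsCentralAlgebra F A ∧
    ∃ (K : Subalgebra F (nucleus F A)) (_ : IsMulCommutative K),
      Algebra.Etale F K ∧
      @IsMinimallyFaithful (K ⊗[F] K) A _ _ (Module.compHom A (biAction K).toRingHom)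

end Semiassociative

/-- A reduced skew set of degree `n`: scalars `c i j k` with `c i i j = c j i i = 1`. -/
structure ReducedSkewSet (F : Type u) [Field F] (n : ℕ) where
  coeff : Fin n → Fin n → Fin n → F
  left_one : ∀ i j, coeff i i j = 1
  right_one : ∀ i j, coeff j i i = 1

/-- The skew matrix algebra `M_n(F; c)`. An element is the array of its coordinates with respect
to the matrix units. -/
def SkewMatrix {F : Type u} [Field F] {n : ℕ} (_c : ReducedSkewSet F n) : Type u :=
  Fin n → Fin n → F

namespace SkewMatrix

variable {F : Type u} [Field F] {n : ℕ} (c : ReducedSkewSet F n)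

instance : AddCommGroup (SkewMatrix c) := inferInstanceAs (AddCommGroup (Fin n → Fin n → F))

instance : Module F (SkewMatrix c) := inferInstanceAs (Module F (Fin n → Fin n → F))

instance : Mul (SkewMatrix c) := ⟨fun x y i l => ∑ j, c.coeff i j l * (x i j * y j l)⟩

instance : One (SkewMatrix c) := ⟨fun i j => if i = j then 1 else 0⟩

variable {c}

theorem mul_apply (x y : SkewMatrix c) (i l : Fin n) :
    (x * y) i l = ∑ j, c.coeff i j l * (x i j * y j l) := rfl

theorem one_apply (i j : Fin n) : (1 : SkewMatrix c) i j = if i = j then 1 else 0 := rfl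

theorem add_apply (x y : SkewMatrix c) (i j : Fin n) : (x + y) i j = x i j + y i j := rfl

theorem zero_apply (i j : Fin n) : (0 : SkewMatrix c) i j = 0 := rfl

theorem smul_apply (r : F) (x : SkewMatrix c) (i j : Fin n) : (r • x) i j = r * x i j := rfl

@[ext]
theorem ext {x y : SkewMatrix c} (h : ∀ i j, x i j = y i j) : x = y :=
  funext fun i => funext fun j => h i j

instance : NonAssocRing (SkewMatrix c) :=
  { (inferInstance : AddCommGroup (SkewMatrix c)),
    (inferInstance : Mul (SkewMatrix c)), (inferInstance : One (SkewMatrix c)) with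
    left_distrib := fun x y z => by
      ext i l; simp only [mul_apply, add_apply, mul_add, Finset.sum_add_distrib]
    right_distrib := fun x y z => by
      ext i l; simp only [mul_apply, add_apply, mul_add, add_mul, Finset.sum_add_distrib]
    zero_mul := fun x => by
      ext i l; simp only [mul_apply, zero_apply, zero_mul, mul_zero, Finset.sum_const_zero]
    mul_zero := fun x => by
      ext i l; simp only [mul_apply, zero_apply, mul_zero, Finset.sum_const_zero]
    one_mul := fun x => by
      ext i l; simp [mul_apply, one_apply, c.left_one]
    mul_one := fun x => by
      ext i l; simp [mul_apply, one_apply, c.right_one] }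

instance : SMulCommClass F (SkewMatrix c) (SkewMatrix c) := ⟨fun r x y => by
  ext i l
  simp only [smul_eq_mul, mul_apply, smul_apply, Finset.mul_sum]
  exact Finset.sum_congr rfl fun j _ => by ring⟩

instance : IsScalarTower F (SkewMatrix c) (SkewMatrix c) := ⟨fun r x y => by
  ext i l
  simp only [smul_eq_mul, mul_apply, smul_apply, Finset.mul_sum]
  exact Finset.sum_congr rfl fun j _ => by ring⟩

variable (c) in
/-- The matrix unit `e_{ij}`. -/
def single (i j : Fin n) : SkewMatrix c := fun k l => if i = k ∧ j = l then 1 else 0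

/-- The defining multiplication rule `e_{ij} e_{kl} = δ_{jk} c_{ijl} e_{il}`. -/
theorem single_mul_single (i j k l : Fin n) :
    single c i j * single c k l = if j = k then c.coeff i j l • single c i l else 0 := by
  ext p q
  rw [mul_apply, Finset.sum_eq_single j]
  · by_cases hjk : j = k
    · subst hjk
      by_cases hp : i = p
      · by_cases hq : l = q
        · subst hp; subst hq; simp [single, smul_apply]
        · simp [single, smul_apply, hq]
      · simp [single, smul_apply, hp]
    · have hkj : ¬ k = j := fun h => hjk h.symm
      simp [single, zero_apply, hjk, hkj]
  · intro m _ hm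
    have hm' : ¬ j = m := fun h => hm h.symm
    simp [single, hm']
  · simp

end SkewMatrix

section Forms

variable (F : Type u) [Field F] (A : Type v) [NonAssocRing A] [Module F A]

/-- `A` is (isomorphic as an `F`-algebra to) a skew matrix algebra `M_n(F; c)` with `n ≥ 1`. -/
def IsSkewMatrixAlgebra : Prop :=
  ∃ (n : ℕ) (_ : 1 ≤ n) (c : ReducedSkewSet F n) (φ : A ≃ₗ[F] SkewMatrix c),
    ∀ x y : A, φ (x * y) = φ x * φ y

variable [SMulCommClass F A A] [IsScalarTower F A A]

/-- `A` is a form of skew matrices: `E ⊗ A` is a skew matrix algebra over `E` for some separable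
field extension `E / F`. Separable is meant in the general sense, which does not ask `E / F` to be
algebraic: `E` stays reduced after extending scalars to an algebraic closure of `F`. -/
def IsFormOfSkewMatrices : Prop :=
  ∃ (E : Type u) (_ : Field E) (_ : Algebra F E),
    Algebra.IsGeometricallyReduced F E ∧ IsSkewMatrixAlgebra E (E ⊗[F] A)

end Forms

end Semiassoc

/-! A nonzero algebra is a skew matrix algebra exactly when it has a frame: orthogonal idempotents
of the nucleus with sum 1, all of whose Peirce components are lines (`IsFrame`). Both directions of
the equivalence move frames between extensions of `F`.

Suppose `A` is semiassociative via `K`. Since `K ⊗ K` is reduced and artinian, minimal faithfulness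
makes `A` free of rank one over it (`IsMinimallyFaithful.exists_bijective`). Over any field `Ω`
splitting `K`, the primitive idempotents of `Ω ⊗ K = Ω^n` then form a frame of `Ω ⊗ A`
(`isFrame_of_bijective`), and a finite separable extension already splits `K`.

Conversely, let `Ω` be separably closed and let `ε i` be the idempotents of a frame of `Ω ⊗ A`. They
lie in `Ω ⊗ N`, where `N` is the nucleus of `A`, but need not come from an étale subalgebra of `N`.
Choose `K` étale in `N` containing every separable element that commutes with it
(`exists_maximal_etale`), and let `C` be its centralizer in `N`. Separable elements of `C` lie in
`K`, hence are central in `C`; Wedderburn–Artin and Jacobson–Noether then make `C` commutative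
modulo its radical, and purely inseparable over `K` there. So a primitive idempotent `f` of `Ω ⊗ K`
stays local in `Ω ⊗ C`: if `f` is a sum of elements of its corner, one of them is invertible there.
Applied to `f = ∑ f * ε i * f`, this makes `f` equivalent to some `ε i`, whose corner is a line
(`exists_mul_corner_eq`, `exists_equivalent_idempotent`). Hence the idempotents of `Ω ⊗ K` belong to
a frame too, so `K ⊗ K` acts faithfully on `A`, and minimality follows by counting dimensions
(`isSemiassociative_of_isFrame`).

Descent from `E` to `F` is the converse applied with `Ω` the algebraic closure of `E`. -/

namespace Semiassoc

/-! ### Frames and skew matrix algebras -/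

section Frames

variable {F : Type u} [Field F] {B : Type v} [NonAssocRing B] [Module F B]
  [SMulCommClass F B B] [IsScalarTower F B B]

/-- Elements of the nucleus forming a complete system of orthogonal idempotents. -/
structure IsNuclearDecomposition (F : Type u) [Field F] {B : Type v} [NonAssocRing B] [Module F B]
    [SMulCommClass F B B] [IsScalarTower F B B] {ι : Type*} [Fintype ι] (e : ι → B) : Prop where
  mem_nucleus : ∀ i, e i ∈ nucleus F B
  mul_self : ∀ i, e i * e i = e i
  mul_of_ne : ∀ i j, i ≠ j → e i * e j = 0
  sum_eq : ∑ i, e i = 1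

/-- A nuclear decomposition all of whose Peirce components are lines, with a chosen generator `u i j`
of the component `e i * B * e j`. -/
structure IsFrame (F : Type u) [Field F] {B : Type v} [NonAssocRing B] [Module F B]
    [SMulCommClass F B B] [IsScalarTower F B B] {ι : Type*} [Fintype ι]
    (e : ι → B) (u : ι → ι → B) : Prop extends IsNuclearDecomposition F e where
  ne_zero : ∀ i j, u i j ≠ 0
  left_mul : ∀ i j, e i * u i j = u i j
  mul_right : ∀ i j, u i j * e j = u i j
  span : ∀ i j x, ∃ r : F, e i * x * e j = r • u i j

section nucleus

variable {x : B}

theorem left_assoc (hx : x ∈ nucleus F B) (a b : B) : x * a * b = x * (a * b) :=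
  (mem_nucleus_iff.1 hx).1 a b

theorem mid_assoc (hx : x ∈ nucleus F B) (a b : B) : a * x * b = a * (x * b) :=
  (mem_nucleus_iff.1 hx).2.1 a b

theorem right_assoc (hx : x ∈ nucleus F B) (a b : B) : a * b * x = a * (b * x) :=
  (mem_nucleus_iff.1 hx).2.2 a b

end nucleus

variable {ι : Type*} [Fintype ι] {e : ι → B} {u : ι → ι → B}

theorem IsNuclearDecomposition.peirce_sum (h : IsNuclearDecomposition F e) (x : B) :
    x = ∑ i, ∑ j, e i * x * e j := by
  simp_rw [← Finset.mul_sum, h.sum_eq, mul_one, ← Finset.sum_mul, h.sum_eq, one_mul]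

namespace IsFrame

variable (h : IsFrame F e u)
include h

theorem u_ne {i j k : ι} (hij : k ≠ i) : e k * u i j = 0 := by
  rw [← h.left_mul i j, ← left_assoc (h.mem_nucleus k), h.mul_of_ne _ _ hij, zero_mul]

theorem u_ne' {i j k : ι} (hij : j ≠ k) : u i j * e k = 0 := by
  rw [← h.mul_right i j, right_assoc (h.mem_nucleus k), h.mul_of_ne _ _ hij, mul_zero]

theorem u_mul_u_of_ne {i j k l : ι} (hjk : j ≠ k) : u i j * u k l = 0 := by
  rw [← h.mul_right i j, mid_assoc (h.mem_nucleus j), h.u_ne hjk, mul_zero]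

theorem exists_mul (i j l : ι) : ∃ r : F, u i j * u j l = r • u i l := by
  obtain ⟨r, hr⟩ := h.span i l (u i j * u j l)
  refine ⟨r, ?_⟩
  rw [← hr, ← left_assoc (h.mem_nucleus i), h.left_mul, right_assoc (h.mem_nucleus l), h.mul_right]

open Classical in
theorem peirce_sum_smul (m : ι → ι → F) (i j : ι) :
    e i * (∑ k, ∑ l, m k l • u k l) * e j = m i j • u i j := by
  simp_rw [Finset.mul_sum, Finset.sum_mul]
  rw [Finset.sum_eq_single i, Finset.sum_eq_single j]
  · rw [mul_smul_comm, h.left_mul, smul_mul_assoc, h.mul_right]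
  · intro l _ hl
    rw [mul_smul_comm, h.left_mul, smul_mul_assoc, h.u_ne' hl, smul_zero]
  · simp
  · intro k _ hk
    exact Finset.sum_eq_zero fun l _ => by
      rw [mul_smul_comm, h.u_ne hk.symm, smul_zero, zero_mul]
  · simp

/-- The linear equivalence between coordinate arrays and the algebra. -/
noncomputable def coordEquiv : (ι → ι → F) ≃ₗ[F] B :=
  LinearEquiv.ofBijective
    { toFun := fun m => ∑ k, ∑ l, m k l • u k l
      map_add' := fun m m' => by simp [add_smul, Finset.sum_add_distrib]
      map_smul' := fun r m => by simp [mul_smul, Finset.smul_sum] }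
    ⟨by
      rw [injective_iff_map_eq_zero]
      intro m hm
      ext i j
      have := h.peirce_sum_smul m i j
      simp only [LinearMap.coe_mk, AddHom.coe_mk] at hm
      rw [hm, mul_zero, zero_mul] at this
      exact (smul_eq_zero.1 this.symm).resolve_right (h.ne_zero i j), by
      intro x
      choose r hr using h.span
      refine ⟨fun i j => r i j x, ?_⟩
      simp only [LinearMap.coe_mk, AddHom.coe_mk, ← hr]
      exact (h.peirce_sum x).symm⟩

theorem finiteDimensional : FiniteDimensional F B := h.coordEquiv.finiteDimensional

theorem finrank_eq : Module.finrank F B = Fintype.card ι * Fintype.card ι := by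
  rw [← h.coordEquiv.finrank_eq]
  simp [Module.finrank_pi_fintype]

theorem e_ne_zero (i : ι) : e i ≠ 0 := fun hi => h.ne_zero i i <| by
  rw [← h.left_mul, hi, zero_mul]

/-- The diagonal generators may be taken to be the idempotents. -/
theorem normalize [DecidableEq ι] : IsFrame F e (fun i j => if i = j then e i else u i j) where
  toIsNuclearDecomposition := h.toIsNuclearDecomposition
  ne_zero i j := by
    split_ifs
    exacts [h.e_ne_zero i, h.ne_zero i j]
  left_mul i j := by
    split_ifs
    exacts [h.mul_self i, h.left_mul i j]
  mul_right i j := by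
    split_ifs with hij
    · subst hij; exact h.mul_self i
    · exact h.mul_right i j
  span i j x := by
    split_ifs with hij
    · subst hij
      obtain ⟨r, hr⟩ := h.span i i x
      -- Taking `x = 1` gives `e i = s • u i i`, so the two generators of the diagonal line differ
      -- by a nonzero scalar.
      obtain ⟨s, hs⟩ := h.span i i 1
      rw [mul_one, h.mul_self] at hs
      have hs0 : s ≠ 0 := fun h0 => h.e_ne_zero i <| by rw [hs, h0, zero_smul]
      exact ⟨r * s⁻¹, by rw [hr, hs, smul_smul, inv_mul_cancel_right₀ hs0]⟩
    · exact h.span i j x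

theorem reindex {κ : Type*} [Fintype κ] (σ : κ ≃ ι) :
    IsFrame F (fun k => e (σ k)) (fun k l => u (σ k) (σ l)) where
  mem_nucleus _ := h.mem_nucleus _
  mul_self _ := h.mul_self _
  mul_of_ne _ _ hij := h.mul_of_ne _ _ (σ.injective.ne hij)
  sum_eq := by rw [σ.sum_comp e, h.sum_eq]
  ne_zero _ _ := h.ne_zero _ _
  left_mul _ _ := h.left_mul _ _
  mul_right _ _ := h.mul_right _ _
  span _ _ x := h.span _ _ x

/-- Elements commuting with everything are scalars. -/
theorem exists_eq_smul_one_of_commute (x : B) (hx : ∀ y, x * y = y * x) :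
    ∃ r : F, x = r • (1 : B) := by
  classical
  have h' := h.normalize
  have hd (i) : ∃ r : F, x * e i = r • e i := by
    obtain ⟨r, hr⟩ := h'.span i i x
    refine ⟨r, ?_⟩
    simp only [if_true] at hr
    rw [← hr, ← hx (e i), right_assoc (h.mem_nucleus i), h.mul_self]
  choose r hr using hd
  -- Moving `x` past `u i j` produces `r i` on one side and `r j` on the other; as no off-diagonal
  -- component vanishes, all diagonal scalars agree.
  have hc (i j) : r i = r j := by
    have h1 : x * u i j = r i • u i j := by
      conv_lhs => rw [← h.left_mul i j, ← mid_assoc (h.mem_nucleus i), hr, smul_mul_assoc,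
        h.left_mul]
    have h2 : u i j * x = r j • u i j := by
      conv_lhs => rw [← h.mul_right i j, mid_assoc (h.mem_nucleus j), ← hx, hr, mul_smul_comm,
        h.mul_right]
    have := h1.symm.trans ((hx _).trans h2)
    exact smul_left_injective F (h.ne_zero i j) this
  have hsum : x = ∑ i, r i • e i := by
    simp_rw [← hr, ← Finset.mul_sum, h.sum_eq, mul_one]
  rcases isEmpty_or_nonempty ι with hι | ⟨⟨i₀⟩⟩
  · exact ⟨0, by rw [hsum]; simp⟩
  · exact ⟨r i₀, by rw [hsum, ← h.sum_eq, Finset.smul_sum]; simp_rw [hc _ i₀]⟩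

/-- The `c i j l` are the structure constants of the generators, `u i j * u j l` being a multiple of
`u i l`. Normalizing `u i i = e i` is what makes this skew set reduced. -/
theorem isSkewMatrixAlgebra [Nontrivial B] : IsSkewMatrixAlgebra F B := by
  classical
  have hι : Nonempty ι := by
    by_contra hι
    rw [not_nonempty_iff] at hι
    exact one_ne_zero (α := B) (by rw [← h.sum_eq]; simp)
  let σ : Fin (Fintype.card ι) ≃ ι := (Fintype.equivFin ι).symm
  have hf := (h.reindex σ).normalize
  generalize hv : (fun i j => if i = j then e (σ i) else u (σ i) (σ j)) = v at hf
  have hvi (i) : v i i = e (σ i) := by rw [← hv]; simp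
  choose c hc using hf.exists_mul
  refine ⟨Fintype.card ι, Fintype.card_pos, ⟨c, fun i j => ?_, fun i j => ?_⟩, ?_⟩
  · have := hc i i j
    rw [hvi, hf.left_mul] at this
    exact smul_left_injective F (hf.ne_zero i j) (by simpa using this.symm)
  · have := hc j i i
    rw [hvi, hf.mul_right] at this
    exact smul_left_injective F (hf.ne_zero j i) (by simpa using this.symm)
  · set C : ReducedSkewSet F (Fintype.card ι) := ⟨c, _, _⟩
    let ψ : SkewMatrix C ≃ₗ[F] B := hf.coordEquiv
    have hψ (m : SkewMatrix C) : ψ m = ∑ k, ∑ l, m k l • v k l := rfl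
    have hmul (m m' : SkewMatrix C) : ψ (m * m') = ψ m * ψ m' := by
      simp_rw [hψ, SkewMatrix.mul_apply, Finset.sum_smul]
      rw [Finset.sum_mul]
      simp_rw [Finset.sum_mul, Finset.mul_sum]
      refine Finset.sum_congr rfl fun i _ => ?_
      rw [Finset.sum_comm]
      refine Finset.sum_congr rfl fun j _ => ?_
      symm
      rw [Finset.sum_eq_single j]
      · refine Finset.sum_congr rfl fun l _ => ?_
        rw [smul_mul_assoc, mul_smul_comm, hc, smul_smul, smul_smul]
        congr 1
        change _ = c i j l * _
        ring
      · intro k _ hk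
        refine Finset.sum_eq_zero fun l _ => ?_
        rw [smul_mul_assoc, mul_smul_comm, hf.u_mul_u_of_ne hk.symm, smul_zero, smul_zero]
      · simp
    refine ⟨ψ.symm, fun x y => ψ.injective ?_⟩
    simp [hmul]

/-- A nuclear decomposition into idempotents equivalent to members of a frame is part of a
frame. -/
theorem exists_of_equivalent {κ : Type*} [Fintype κ] {f : κ → B}
    (hf : IsNuclearDecomposition F f) (s : κ → ι) (a b : κ → B)
    (ha : ∀ k, a k ∈ nucleus F B) (hb : ∀ k, b k ∈ nucleus F B)
    (hab : ∀ k, a k * b k = f k) (hba : ∀ k, b k * a k = e (s k)) :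
    ∃ v, IsFrame F f v := by
  have hba' (k) (y : B) : b k * (a k * y) = e (s k) * y := by rw [← left_assoc (hb k), hba]
  have hab' (k) (y : B) : a k * (b k * y) = f k * y := by rw [← left_assoc (ha k), hab]
  -- The map `x ↦ a k * x * b l` carries the component at `(s k, s l)` to the one at `(k, l)`, with
  -- inverse `y ↦ b k * y * a l`. No injectivity of `s` enters.
  have key (k l) (x : B) : b k * (a k * x * b l) * a l = e (s k) * x * e (s l) := by
    simp only [left_assoc (ha _), right_assoc (ha _), right_assoc (h.mem_nucleus _), hba', hba]
  have hae (k) : a k * e (s k) = f k * a k := by rw [← hba, ← left_assoc (ha k), hab]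
  have heb (k) : e (s k) * b k = b k * f k := by rw [← hba, left_assoc (hb k), hab]
  refine ⟨fun k l => a k * u (s k) (s l) * b l, ⟨hf, ?_, ?_, ?_, ?_⟩⟩
  · intro k l h0
    apply h.ne_zero (s k) (s l)
    have := key k l (u (s k) (s l))
    rw [h.left_mul, h.mul_right] at this
    rw [← this]
    rw [h0, mul_zero, zero_mul]
  · intro k l
    rw [← left_assoc (hf.mem_nucleus k), ← left_assoc (hf.mem_nucleus k), ← hae,
      left_assoc (ha k), h.left_mul]
  · intro k l
    rw [right_assoc (hf.mem_nucleus l), ← heb, ← right_assoc (hb l),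
      mid_assoc (h.mem_nucleus _), ← right_assoc (hb l), right_assoc (h.mem_nucleus _),
      h.mul_right]
  · intro k l x
    obtain ⟨r, hr⟩ := h.span (s k) (s l) (b k * x * a l)
    refine ⟨r, ?_⟩
    rw [← smul_mul_assoc, ← mul_smul_comm, ← hr, ← hba, ← hba, ← hab, ← hab]
    simp only [left_assoc (ha _), left_assoc (hb _), right_assoc (hb _), mid_assoc (ha _)]
    simp only [hab, hab', ← left_assoc (hf.mem_nucleus _), hf.mul_self]

end IsFrame

theorem SkewMatrix.single_mul_apply {n : ℕ} {c : ReducedSkewSet F n} (i j : Fin n)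
    (x : SkewMatrix c) (k l : Fin n) :
    (single c i j * x) k l = if i = k then c.coeff i j l * x j l else 0 := by
  rw [mul_apply]
  split_ifs with h
  · subst h
    rw [Finset.sum_eq_single j]
    · simp [single]
    · intro m _ hm
      simp [single, hm.symm]
    · simp
  · exact Finset.sum_eq_zero fun m _ => by simp [single, h]

theorem SkewMatrix.mul_single_apply {n : ℕ} {c : ReducedSkewSet F n} (i j : Fin n)
    (x : SkewMatrix c) (k l : Fin n) :
    (x * single c i j) k l = if j = l then c.coeff k i j * x k i else 0 := by
  rw [mul_apply]
  split_ifs with h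
  · subst h
    rw [Finset.sum_eq_single i]
    · simp [single]
    · intro m _ hm
      simp [single, hm.symm]
    · simp
  · exact Finset.sum_eq_zero fun m _ => by simp [single, h]

/-- Since `c i i l = c k i i = 1`, multiplying by a diagonal unit just selects a row or a column, as
for ordinary matrices. -/
theorem SkewMatrix.single_self_mem_nucleus {n : ℕ} (c : ReducedSkewSet F n) (i : Fin n) :
    single c i i ∈ nucleus F (SkewMatrix c) := by
  rw [mem_nucleus_iff]
  refine ⟨fun a b => ?_, fun a b => ?_, fun a b => ?_⟩
  · ext k l
    rw [single_mul_apply, mul_apply, mul_apply]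
    simp_rw [single_mul_apply]
    split_ifs with h
    · subst h; simp [c.left_one]
    · simp
  · ext k l
    rw [mul_apply, mul_apply]
    simp_rw [single_mul_apply, mul_single_apply]
    refine Finset.sum_congr rfl fun j _ => ?_
    split_ifs with h
    · subst h; simp [c.left_one, c.right_one]
    · simp
  · ext k l
    rw [mul_single_apply, mul_apply, mul_apply]
    simp_rw [mul_single_apply]
    split_ifs with h
    · subst h; simp [c.right_one]
    · simp

theorem SkewMatrix.isFrame {n : ℕ} (c : ReducedSkewSet F n) :
    IsFrame F (fun i => single c i i) (fun i j => single c i j) where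
  mem_nucleus := single_self_mem_nucleus c
  mul_self i := by rw [single_mul_single, if_pos rfl, c.left_one, one_smul]
  mul_of_ne i j hij := by rw [single_mul_single, if_neg hij]
  sum_eq := by
    ext k l
    have hs : (∑ i, single c i i) k l = ∑ i, single c i i k l :=
      map_sum ({ toFun := fun x => x k l, map_zero' := rfl, map_add' := fun _ _ => rfl } :
        SkewMatrix c →+ F) (fun i => single c i i) Finset.univ
    rw [hs, one_apply, Finset.sum_eq_single k]
    · simp [single]
    · intro i _ hi
      simp [single, hi]
    · simp
  ne_zero i j h0 := by
    have := congrFun (congrFun h0 i) j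
    simp [single, zero_apply] at this
  left_mul i j := by rw [single_mul_single, if_pos rfl, c.left_one, one_smul]
  mul_right i j := by rw [single_mul_single, if_pos rfl, c.right_one, one_smul]
  span i j x := ⟨x i j, by
    ext k l
    rw [mul_single_apply, smul_apply]
    simp_rw [single_mul_apply]
    by_cases h : j = l <;> by_cases h' : i = k
    · subst h; subst h'; simp [single, c.left_one, c.right_one]
    all_goals simp [single, h, h']⟩

theorem IsFrame.map {B' : Type*} [NonAssocRing B'] [Module F B'] [SMulCommClass F B' B']
    [IsScalarTower F B' B'] (h : IsFrame F e u) (φ : B ≃ₗ[F] B')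
    (hφ : ∀ x y, φ (x * y) = φ x * φ y) :
    IsFrame F (fun i => φ (e i)) (fun i j => φ (u i j)) := by
  have hφ1 : φ 1 = 1 := by
    have := hφ 1 (φ.symm 1)
    rw [one_mul, φ.apply_symm_apply, mul_one] at this
    exact this.symm
  refine ⟨⟨fun i => ?_, fun i => ?_, fun i j hij => ?_, ?_⟩, fun i j => ?_, fun i j => ?_,
    fun i j => ?_, fun i j x => ?_⟩
  · rw [mem_nucleus_iff]
    have hn := h.mem_nucleus i
    refine ⟨fun a b => ?_, fun a b => ?_, fun a b => ?_⟩ <;>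
      obtain ⟨a, rfl⟩ := φ.surjective a <;> obtain ⟨b, rfl⟩ := φ.surjective b <;>
      simp_rw [← hφ]
    · rw [left_assoc hn]
    · rw [mid_assoc hn]
    · rw [right_assoc hn]
  · rw [← hφ, h.mul_self]
  · rw [← hφ, h.mul_of_ne _ _ hij, map_zero]
  · rw [← map_sum, h.sum_eq, hφ1]
  · simpa using h.ne_zero i j
  · rw [← hφ, h.left_mul]
  · rw [← hφ, h.mul_right]
  · obtain ⟨x, rfl⟩ := φ.surjective x
    obtain ⟨r, hr⟩ := h.span i j x
    exact ⟨r, by rw [← hφ, ← hφ, hr, map_smul]⟩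

theorem IsSkewMatrixAlgebra.exists_isFrame (h : IsSkewMatrixAlgebra F B) :
    ∃ (n : ℕ) (_ : 1 ≤ n) (e : Fin n → B) (u : Fin n → Fin n → B), IsFrame F e u := by
  obtain ⟨n, hn, c, φ, hφ⟩ := h
  refine ⟨n, hn, _, _, (SkewMatrix.isFrame c).map φ.symm fun x y => φ.injective ?_⟩
  simp [hφ]

end Frames

/-! ### Minimally faithful modules over reduced artinian rings -/

section MinimallyFaithful

/-- A faithful module over a reduced artinian commutative ring has an element with zero
annihilator. -/
theorem exists_injective_smul (R : Type*) [CommRing R] [IsReduced R] [IsArtinianRing R]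
    (M : Type*) [AddCommGroup M] [Module R M] [FaithfulSMul R M] :
    ∃ m : M, ∀ r : R, r • m = 0 → r = 0 := by
  classical
  let φ := IsArtinianRing.equivPi R
  have : Finite (MaximalSpectrum R) := inferInstance
  cases nonempty_fintype (MaximalSpectrum R)
  let ε (p : MaximalSpectrum R) : R := φ.symm (Pi.single p 1)
  have hφ (r : R) (p) : φ r p = Ideal.Quotient.mk p.asIdeal r := rfl
  have hε (p) : φ (ε p) = Pi.single p 1 := φ.apply_symm_apply _
  -- The ring is a product of fields with idempotents `ε p`. Faithfulness gives a vector not killed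
  -- by each factor, and the sum of their components has zero annihilator.
  have hne (p) : ∃ m : M, ε p • m ≠ 0 := by
    by_contra! h
    have h0 : ε p = 0 := FaithfulSMul.eq_of_smul_eq_smul (α := M) fun m => by rw [h, zero_smul]
    have := congrFun (hε p) p
    rw [h0, map_zero, Pi.zero_apply, Pi.single_eq_same] at this
    exact zero_ne_one this
  choose m hm using hne
  refine ⟨∑ p, ε p • m p, fun r hr => ?_⟩
  apply φ.injective
  rw [map_zero]
  funext p
  rw [Pi.zero_apply, hφ]
  by_contra hrp
  let _ : Field (R ⧸ p.asIdeal) := Ideal.Quotient.field p.asIdeal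
  obtain ⟨s, hs⟩ := Ideal.Quotient.mk_surjective (Ideal.Quotient.mk p.asIdeal r)⁻¹
  have hsr : s * r * ε p = ε p := by
    apply φ.injective
    rw [map_mul, hε]
    funext q
    by_cases hq : q = p
    · subst hq
      rw [Pi.mul_apply, Pi.single_eq_same, mul_one, hφ, map_mul, hs, inv_mul_cancel₀ hrp]
    · rw [Pi.mul_apply, Pi.single_eq_of_ne hq, mul_zero]
  have hmul (q) (hq : q ≠ p) : ε p * ε q = 0 := by
    apply φ.injective
    rw [map_mul, hε, hε, map_zero]
    funext q'
    by_cases h : q' = p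
    · subst h
      rw [Pi.mul_apply, Pi.single_eq_of_ne hq.symm, mul_zero, Pi.zero_apply]
    · rw [Pi.mul_apply, Pi.single_eq_of_ne h, zero_mul, Pi.zero_apply]
  have hself : ε p * ε p = ε p := by
    apply φ.injective
    rw [map_mul, hε, ← Pi.single_mul, mul_one]
  apply hm p
  calc ε p • m p = ε p • ∑ q, ε q • m q := by
        rw [Finset.smul_sum, Finset.sum_eq_single p]
        · rw [smul_smul, hself]
        · intro q _ hq
          rw [smul_smul, hmul q hq, zero_smul]
        · simp
    _ = (s * ε p) • r • ∑ q, ε q • m q := by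
        conv_lhs => rw [← hsr]
        rw [smul_smul]
        congr 1
        ring
    _ = 0 := by rw [hr, smul_zero]

variable {F : Type*} [Field F] {R : Type u} [CommRing R] [Algebra F R] [FiniteDimensional F R]
  {M : Type v} [AddCommGroup M] [Module F M] [Module R M] [IsScalarTower F R M]

/-- The submodule spanned by an element with zero annihilator is itself a faithful section, so by
minimality it is the whole module. -/
theorem IsMinimallyFaithful.exists_bijective {R : Type u} [CommRing R] [IsReduced R]
    [IsArtinianRing R] {M : Type v} [AddCommGroup M] [Module R M] (h : IsMinimallyFaithful R M) :
    ∃ m : M, Function.Bijective (fun r : R => r • m) := by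
  obtain ⟨hf, hmin⟩ := h
  obtain ⟨m, hm⟩ := exists_injective_smul R M
  refine ⟨m, ?_, ?_⟩
  · intro r s hrs
    rw [← sub_eq_zero]
    exact hm _ (by rw [sub_smul, sub_eq_zero]; exact hrs)
  · have hq := (hmin ⊥ (Submodule.span R {m}) bot_le ⟨fun {r s} hrs => by
      rw [← sub_eq_zero]
      apply hm
      have := hrs (Submodule.Quotient.mk ⟨m, Submodule.mem_span_singleton_self m⟩)
      rw [← Submodule.Quotient.mk_smul, ← Submodule.Quotient.mk_smul,
        Submodule.Quotient.eq] at this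
      have h0 : r • m - s • m ∈ (⊥ : Submodule R M) := this
      rwa [Submodule.mem_bot, ← sub_smul] at h0⟩).2
    intro x
    exact Submodule.mem_span_singleton.1 (hq ▸ Submodule.mem_top : x ∈ Submodule.span R {m})

/-- A faithful section `Q / P` contains a vector with zero annihilator. Lifted to `q` in `Q`, it
spans a copy of `R` that meets `P` trivially and fills `M` by dimension. -/
theorem isMinimallyFaithful_of_finrank_eq [IsReduced R] [FiniteDimensional F M]
    (hf : FaithfulSMul R M) (hd : Module.finrank F M = Module.finrank F R) :
    IsMinimallyFaithful R M := by
  have : IsArtinianRing R := .of_finite F R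
  refine ⟨hf, fun P Q _ hfQ => ?_⟩
  obtain ⟨m, hm⟩ := exists_injective_smul R (Q ⧸ P.submoduleOf Q)
  obtain ⟨q, rfl⟩ := Submodule.Quotient.mk_surjective _ m
  have hq (r : R) (hr : r • (q : M) ∈ P) : r = 0 := by
    refine hm r ?_
    rw [← Submodule.Quotient.mk_smul, Submodule.Quotient.mk_eq_zero]
    exact hr
  let f : R →ₗ[F] M := (LinearMap.toSpanSingleton R M (q : M)).restrictScalars F
  have hf (r : R) : f r = r • (q : M) := rfl
  have hinj : Function.Injective f := by
    rw [← LinearMap.ker_eq_bot, LinearMap.ker_eq_bot']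
    exact fun r hr => hq r (by rw [← hf, hr]; exact P.zero_mem)
  have hrange : Module.finrank F (LinearMap.range f) = Module.finrank F M := by
    rw [LinearMap.finrank_range_of_inj hinj, hd]
  have htop := Submodule.eq_top_of_finrank_eq hrange
  have hsurj (x : M) : ∃ r : R, r • (q : M) = x := by
    have hx : x ∈ LinearMap.range f := htop ▸ Submodule.mem_top
    exact hx
  constructor
  · rw [eq_bot_iff]
    intro x hx
    obtain ⟨r, rfl⟩ := hsurj x
    rw [hq r hx, zero_smul]
    exact Submodule.zero_mem _
  · rw [eq_top_iff]
    intro x _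
    obtain ⟨r, rfl⟩ := hsurj x
    exact Q.smul_mem r q.2

end MinimallyFaithful

/-! ### Splitting fields of étale algebras -/

section Splitting

theorem isFiniteSplit_of_isSepClosed {F : Type*} [Field F] (K : Type*) [CommRing K]
    [Algebra F K] [Algebra.Etale F K] (Ω : Type*) [Field Ω] [Algebra F Ω] [IsSepClosed Ω] :
    Algebra.IsFiniteSplit Ω (Ω ⊗[F] K) :=
  inferInstance

variable {F : Type u} [Field F] {K : Type v} [CommRing K] [Algebra F K]

/-- If the characters splitting `Ω ⊗ K` take values in a subextension `E`, then `E` splits `K`. -/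
theorem isFiniteSplit_of_forall_mem [FiniteDimensional F K] {Ω : Type w} [Field Ω] [Algebra F Ω]
    {n : ℕ} (e : Ω ⊗[F] K ≃ₐ[Ω] (Fin n → Ω)) (E : IntermediateField F Ω)
    (hE : ∀ i k, e (1 ⊗ₜ k) i ∈ E) : Algebra.IsFiniteSplit E (E ⊗[F] K) := by
  let σ (i : Fin n) : K →ₐ[F] Ω :=
    ((Pi.evalAlgHom Ω (fun _ => Ω) i).comp e.toAlgHom).restrictScalars F |>.comp
      Algebra.TensorProduct.includeRight
  let τ (i : Fin n) : K →ₐ[F] E := (σ i).codRestrict E.toSubalgebra (hE i)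
  have hτ (i) (k : K) : (τ i k : Ω) = e (1 ⊗ₜ k) i := rfl
  let Φ : E ⊗[F] K →ₐ[E] (Fin n → E) :=
    Algebra.TensorProduct.lift (Algebra.ofId E _) (AlgHom.pi τ)
      (fun _ _ => Commute.all _ _)
  have hΦ (x : E) (k : K) (i) : Φ (x ⊗ₜ k) i = x * τ i k := by
    simp [Φ, Algebra.ofId_apply]
  clear_value Φ τ
  -- Viewed in `Ω`, `Φ` is the restriction of `e` to `E ⊗ K`; equality of dimensions then upgrades
  -- injectivity to bijectivity.
  have hinj : Function.Injective Φ := by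
    have h1 : Function.Injective (LinearMap.rTensor K E.val.toLinearMap) :=
      Module.Flat.rTensor_preserves_injective_linearMap _ E.val.injective
    have h2 (x : E ⊗[F] K) (i) :
        ((Φ x i : E) : Ω) = e (LinearMap.rTensor K E.val.toLinearMap x) i := by
      induction x with
      | zero => simp
      | add x y hx hy => simp only [map_add, Pi.add_apply, IntermediateField.coe_add, hx, hy]
      | tmul x k =>
        rw [hΦ, LinearMap.rTensor_tmul]
        have : (E.val.toLinearMap x) ⊗ₜ[F] k = (x : Ω) • ((1 : Ω) ⊗ₜ[F] k) := by
          rw [TensorProduct.smul_tmul', smul_eq_mul, mul_one]; rfl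
        rw [this, map_smul, Pi.smul_apply, smul_eq_mul, IntermediateField.coe_mul, hτ]
    intro x y hxy
    apply h1
    apply e.injective
    funext i
    rw [← h2, ← h2, hxy]
  have hdim : Module.finrank E (E ⊗[F] K) = Module.finrank E (Fin n → E) := by
    rw [Module.finrank_baseChange, Module.finrank_fin_fun, ← Module.finrank_baseChange (R := Ω),
      e.toLinearEquiv.finrank_eq, Module.finrank_fin_fun]
  exact ⟨n, ⟨AlgEquiv.ofBijective Φ ⟨hinj,
    (LinearMap.injective_iff_surjective_of_finrank_eq_finrank (f := Φ.toLinearMap) hdim).1 hinj⟩⟩⟩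

/-- It suffices to adjoin the values of the finitely many characters on a finite basis of `K`. -/
theorem exists_intermediateField_isFiniteSplit [FiniteDimensional F K] {Ω : Type w} [Field Ω]
    [Algebra F Ω] [Algebra.IsAlgebraic F Ω] (h : Algebra.IsFiniteSplit Ω (Ω ⊗[F] K)) :
    ∃ E : IntermediateField F Ω, FiniteDimensional F E ∧ Algebra.IsFiniteSplit E (E ⊗[F] K) := by
  obtain ⟨n, ⟨e⟩⟩ := h.nonempty_algEquiv_fun
  let b := Module.finBasis F K
  let S : Set Ω := Set.range fun p : Fin n × Fin (Module.finrank F K) => e (1 ⊗ₜ b p.2) p.1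
  refine ⟨IntermediateField.adjoin F S, ?_, isFiniteSplit_of_forall_mem e _ fun i k => ?_⟩
  · have : Finite S := Set.finite_range _
    exact IntermediateField.finiteDimensional_adjoin fun x _ => Algebra.IsIntegral.isIntegral x
  · have hk : e (1 ⊗ₜ k) i = ∑ j, b.repr k j • e (1 ⊗ₜ b j) i := by
      conv_lhs => rw [← b.sum_repr k, TensorProduct.tmul_sum, map_sum, Finset.sum_apply]
      refine Finset.sum_congr rfl fun j _ => ?_
      rw [TensorProduct.tmul_smul, ← algebraMap_smul Ω (b.repr k j), map_smul, Pi.smul_apply,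
        algebraMap_smul]
    rw [hk]
    exact sum_mem fun j _ => IntermediateField.smul_mem _
      (IntermediateField.subset_adjoin F S ⟨(i, j), rfl⟩)

/-- An étale algebra is split by a finite separable field extension. -/
theorem exists_finite_separable_isFiniteSplit (F : Type u) [Field F] (K : Type v) [CommRing K]
    [Algebra F K] [Algebra.Etale F K] :
    ∃ (E : Type u) (_ : Field E) (_ : Algebra F E), FiniteDimensional F E ∧
      Algebra.IsSeparable F E ∧ Algebra.IsFiniteSplit E (E ⊗[F] K) := by
  have hK : FiniteDimensional F K := Algebra.FormallyUnramified.finite_of_free F K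
  obtain ⟨E, hE, hs⟩ := exists_intermediateField_isFiniteSplit
    (isFiniteSplit_of_isSepClosed (F := F) K (SeparableClosure F))
  exact ⟨E, inferInstance, inferInstance, hE, inferInstance, hs⟩

end Splitting

/-! ### Maximal étale subalgebras -/

section MaximalEtale

variable {F : Type u} [Field F] {N : Type v} [Ring N] [Algebra F N]

open scoped IsMulCommutative KaehlerDifferential in
/-- Adjoining a commuting separable element to an unramified subalgebra gives an unramified
subalgebra. -/
theorem exists_formallyUnramified_adjoin (K : Subalgebra F N) [IsMulCommutative K]
    [Algebra.FormallyUnramified F K] (y : N) (hy : ∀ k ∈ K, k * y = y * k)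
    (hsep : IsSeparable F y) :
    ∃ (L : Subalgebra F N) (_ : IsMulCommutative L),
      Algebra.FormallyUnramified F L ∧ K ≤ L ∧ y ∈ L := by
  let s : Set N := K ∪ {y}
  let L := Algebra.adjoin F s
  have hL : IsMulCommutative L := Algebra.isMulCommutative_adjoin F (by
    rintro a (ha | rfl) b (hb | rfl)
    · exact congrArg Subtype.val (mul_comm' (⟨a, ha⟩ : K) ⟨b, hb⟩)
    · exact hy a ha
    · exact (hy b hb).symm
    · rfl)
  have hKL : K ≤ L := fun k hk => Algebra.subset_adjoin (Or.inl hk)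
  have hyL : y ∈ L := Algebra.subset_adjoin (Or.inr rfl)
  refine ⟨L, hL, ⟨?_⟩, hKL, hyL⟩
  -- The universal derivation need only vanish on generators. On `K` it factors through the zero
  -- differentials of `K`; on `y` it is killed by `f'(y)`, a unit because the minimal polynomial `f`
  -- is separable and `f(y) = 0`.
  have hD : KaehlerDifferential.D F L = 0 := by
    refine Derivation.ext_of_adjoin_eq_top _ (Algebra.adjoin_adjoin_coe_preimage (s := s)) ?_
    rintro y' (hxK | hy')
    · let _ : Algebra K L := (Subalgebra.inclusion hKL).toAlgebra
      have : IsScalarTower F K L := .of_algebraMap_eq fun _ => rfl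
      have h := KaehlerDifferential.map_D F F K L ⟨y', hxK⟩
      rw [Subsingleton.elim (KaehlerDifferential.D F K ⟨y', hxK⟩) 0, map_zero] at h
      exact h.symm
    · rw [Set.mem_singleton_iff] at hy'
      have h0 : Polynomial.aeval y' (minpoly F y) = 0 := by
        apply Subtype.ext
        have := Polynomial.aeval_algHom_apply L.val y' (minpoly F y)
        rw [← Subalgebra.coe_val, ← this, Subalgebra.coe_val, hy']
        exact minpoly.aeval F y
      have h1 : Polynomial.aeval y' (minpoly F y).derivative • KaehlerDifferential.D F L y' = 0 := by
        rw [← Derivation.map_aeval, h0, map_zero]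
      obtain ⟨a, b, hab⟩ := hsep
      have h2 := congrArg (Polynomial.aeval y') hab
      rw [map_add, map_mul, map_mul, h0, mul_zero, zero_add, map_one] at h2
      change KaehlerDifferential.D F L y' = 0
      rw [← one_smul L (KaehlerDifferential.D F L y'), ← h2, mul_smul, h1, smul_zero]
  have htop := KaehlerDifferential.span_range_derivation F L
  rw [hD] at htop
  have : (⊤ : Submodule L Ω[L⁄F]) = ⊥ := by
    rw [← htop, Submodule.span_eq_bot]
    rintro _ ⟨x, rfl⟩
    rfl
  exact (Submodule.subsingleton_iff L).1 (subsingleton_of_bot_eq_top this.symm)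

open scoped IsMulCommutative in
/-- A finite dimensional associative algebra has an étale subalgebra containing every separable
element that commutes with it. -/
theorem exists_maximal_etale (F : Type u) [Field F] (N : Type v) [Ring N] [Algebra F N]
    [FiniteDimensional F N] :
    ∃ (K : Subalgebra F N) (_ : IsMulCommutative K), Algebra.Etale F K ∧
      ∀ y, (∀ k ∈ K, k * y = y * k) → IsSeparable F y → y ∈ K := by
  let P (K : Subalgebra F N) : Prop :=
    ∃ _ : IsMulCommutative K, Algebra.FormallyUnramified F K
  have hbot : P ⊥ := by
    have hc : IsMulCommutative (⊥ : Subalgebra F N) := by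
      rw [← Algebra.adjoin_empty]
      exact Algebra.isMulCommutative_adjoin F (by simp)
    exact ⟨hc, .of_surjective (Algebra.ofId F (⊥ : Subalgebra F N)) (by
      rintro ⟨x, hx⟩
      obtain ⟨r, rfl⟩ := Algebra.mem_bot.1 hx
      exact ⟨r, rfl⟩)⟩
  -- Least codimension means greatest dimension, so adjoining a commuting separable element cannot
  -- enlarge `K`.
  obtain ⟨K, hK, hmax⟩ := (measure fun K : Subalgebra F N =>
    Module.finrank F N - Module.finrank F K).wf.has_min {K | P K} ⟨⊥, hbot⟩
  obtain ⟨hc, hu⟩ := hK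
  have hfp : Algebra.FinitePresentation F K := .of_finiteType.1 inferInstance
  refine ⟨K, hc, ⟨.of_formallyUnramified_of_field F K, hfp⟩, fun y hy hs => ?_⟩
  obtain ⟨L, hL, hLu, hKL, hyL⟩ := exists_formallyUnramified_adjoin K y hy hs
  have h1 := hmax L ⟨hL, hLu⟩
  have h2 : Module.finrank F L ≤ Module.finrank F N := Submodule.finrank_le L.toSubmodule
  have h3 : Module.finrank F L ≤ Module.finrank F K := by
    have : Module.finrank F K ≤ Module.finrank F N := Submodule.finrank_le K.toSubmodule
    change ¬ (Module.finrank F N - Module.finrank F L < Module.finrank F N - Module.finrank F K) at h1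
    omega
  have := Submodule.eq_of_le_of_finrank_le (S₁ := K.toSubmodule) (S₂ := L.toSubmodule) hKL h3
  exact (this ▸ hyL : y ∈ K.toSubmodule)

end MaximalEtale

/-! ### Separable parts of elements -/

section Separable

open Polynomial

variable {F : Type u} [Field F] (q : ℕ) [ExpChar F q]

theorem prod_X_sub_C_dvd_pow_card {R : Type*} [CommRing R] (s : Multiset R) (H : R[X])
    (h : ∀ a ∈ s, X - C a ∣ H) : (s.map fun a => X - C a).prod ∣ H ^ s.card := by
  induction s using Multiset.induction with
  | empty => simp
  | cons a s ih =>
    rw [Multiset.map_cons, Multiset.prod_cons, Multiset.card_cons, pow_succ']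
    exact mul_dvd_mul (h a (Multiset.mem_cons_self a s))
      (ih fun b hb => h b (Multiset.mem_cons_of_mem hb))

/-- For `m` large, `α ^ q ^ m` is separable for every root `α` of `g`. Take `h` to be the product of
the distinct minimal polynomials of these powers: each root of `g` is a root of `h(X ^ q ^ m)`, and
the exponent `a` takes care of multiplicities. -/
theorem exists_separable_dvd_expand_pow (g : F[X]) (hg : g ≠ 0) :
    ∃ (h : F[X]) (m a : ℕ), h.Separable ∧ g ∣ (expand F (q ^ m) h) ^ a := by
  classical
  let Ω := AlgebraicClosure F
  have hroot (α : Ω) : ∃ m : ℕ, IsSeparable F (α ^ q ^ m) := by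
    have : ExpChar (separableClosure F Ω) q := expChar_of_injective_algebraMap
      (algebraMap F (separableClosure F Ω)).injective q
    obtain ⟨m, s, hs⟩ := IsPurelyInseparable.pow_mem (separableClosure F Ω) q α
    exact ⟨m, hs ▸ mem_separableClosure_iff.1 s.2⟩
  choose m hm using hroot
  let R : Finset Ω := (g.map (algebraMap F Ω)).roots.toFinset
  let M := R.sup m
  have hM (α) (hα : α ∈ R) : IsSeparable F (α ^ q ^ M) := by
    have hle : m α ≤ M := Finset.le_sup hα
    have : α ^ q ^ M = (α ^ q ^ m α) ^ q ^ (M - m α) := by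
      rw [← pow_mul, ← pow_add, Nat.add_sub_cancel' hle]
    rw [this]
    exact mem_separableClosure_iff.1 (pow_mem (mem_separableClosure_iff.2 (hm α)) _)
  let T : Finset F[X] := R.image fun α => minpoly F (α ^ q ^ M)
  have hT : ∀ p ∈ T, Irreducible p ∧ p.Monic ∧ p.Separable := by
    intro p hp
    obtain ⟨α, hα, rfl⟩ := Finset.mem_image.1 hp
    have hi := (hM α hα).isIntegral
    exact ⟨minpoly.irreducible hi, minpoly.monic hi, hM α hα⟩
  refine ⟨∏ p ∈ T, p, M, (g.map (algebraMap F Ω)).roots.card, ?_, ?_⟩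
  · refine separable_prod' (fun x hx y hy hxy => ?_) fun p hp => (hT p hp).2.2
    refine ((hT x hx).1.coprime_iff_not_dvd).2 fun hd => hxy ?_
    exact eq_of_monic_of_associated (hT x hx).2.1 (hT y hy).2.1
      ((hT x hx).1.associated_of_dvd (hT y hy).1 hd)
  · rw [← map_dvd_map' (algebraMap F Ω)]
    have hsp := IsAlgClosed.splits (g.map (algebraMap F Ω))
    have hdvd : ((g.map (algebraMap F Ω)).roots.map fun a => X - C a).prod ∣
        (map (algebraMap F Ω) (expand F (q ^ M) (∏ p ∈ T, p))) ^
          (g.map (algebraMap F Ω)).roots.card := by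
      refine prod_X_sub_C_dvd_pow_card (R := AlgebraicClosure F) _ _ fun α hα => ?_
      rw [dvd_iff_isRoot (R := AlgebraicClosure F), IsRoot.def, eval_map_algebraMap, expand_aeval,
        map_prod]
      exact Finset.prod_eq_zero
        (Finset.mem_image_of_mem _ (Multiset.mem_toFinset.2 hα)) (minpoly.aeval F _)
    rw [Polynomial.map_pow]
    rw [← C_mul_dvd (leadingCoeff_ne_zero.2 (map_ne_zero hg)), ← hsp.eq_prod_roots] at hdvd
    exact hdvd

open scoped IsMulCommutative in
/-- In a finite dimensional algebra, some `q`-power of every element is the sum of a separable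
element and a nilpotent one, where `q` is the characteristic exponent. -/
theorem exists_isNilpotent_pow_sub {C : Type v} [Ring C] [Algebra F C] [FiniteDimensional F C]
    (y : C) : ∃ (m : ℕ) (s : C), IsSeparable F s ∧ IsNilpotent (y ^ q ^ m - s) := by
  have hy : IsIntegral F y := Algebra.IsIntegral.isIntegral y
  obtain ⟨h, m, a, hs, hd⟩ := exists_separable_dvd_expand_pow q (minpoly F y) (minpoly.ne_zero hy)
  let B := Algebra.adjoin F {y}
  have hB : IsMulCommutative B := Algebra.isMulCommutative_adjoin F (by simp)
  let y' : B := ⟨y, Algebra.self_mem_adjoin_singleton F y⟩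
  have hnil : IsNilpotent (aeval (y' ^ q ^ m) h) := by
    refine ⟨a, Subtype.val_injective ?_⟩
    obtain ⟨g, hg⟩ := hd
    have h0 : aeval y ((expand F (q ^ m) h) ^ a) = 0 := by
      rw [hg, map_mul, minpoly.aeval, zero_mul]
    rw [map_pow, expand_aeval] at h0
    change B.val ((aeval (y' ^ q ^ m) h) ^ a) = 0
    rw [map_pow, ← aeval_algHom_apply, map_pow]
    exact h0
  have hunit : IsUnit (aeval (y' ^ q ^ m) (derivative h)) := by
    obtain ⟨c, d, hcd⟩ := hs
    have h1 := congrArg (aeval (y' ^ q ^ m)) hcd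
    rw [map_add, map_mul, map_mul, map_one] at h1
    have h2 : IsUnit (aeval (y' ^ q ^ m) d * aeval (y' ^ q ^ m) (derivative h)) := by
      rw [← eq_sub_iff_add_eq'] at h1
      rw [h1]
      exact ((Commute.all _ _).isNilpotent_mul_left hnil).isUnit_one_sub
    exact isUnit_of_mul_isUnit_right h2
  -- Newton iteration: `y ^ q ^ m` is a root of `h` up to a nilpotent and `h'` is a unit there, so
  -- an exact root, necessarily separable, lies within a nilpotent of it.
  obtain ⟨r, ⟨hr, hr0⟩, -⟩ := existsUnique_nilpotent_sub_and_aeval_eq_zero hnil hunit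
  refine ⟨m, r, ?_, ?_⟩
  · refine Separable.of_dvd hs (minpoly.dvd F _ ?_)
    have := aeval_algHom_apply B.val r h
    rw [hr0, map_zero] at this
    exact this
  · obtain ⟨b, hb⟩ := hr
    exact ⟨b, congrArg Subtype.val hb⟩

end Separable

/-! ### Algebras whose separable elements are central -/

section Radical

/-- A division ring that is radical over its center (for powers of the characteristic exponent) is
commutative. -/
theorem mul_comm_of_pow_mem_center (D : Type*) [DivisionRing D] (q : ℕ) [hq : ExpChar D q]
    (h : ∀ x : D, ∃ m : ℕ, x ^ q ^ m ∈ Subring.center D) (x y : D) : x * y = y * x := by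
  have : ExpChar (Subring.center D) q := ExpChar.expChar_center_iff.2 hq
  have hp : IsPurelyInseparable (Subring.center D) D :=
    (isPurelyInseparable_iff_pow_mem (Subring.center D) q).2 fun x => by
      obtain ⟨m, hm⟩ := h x
      exact ⟨m, ⟨_, hm⟩, rfl⟩
  have : Algebra.IsAlgebraic (Subring.center D) D := hp.isAlgebraic
  by_contra hxy
  have hne : Subring.center D ≠ ⊤ := fun htop => hxy <|
    ((Subring.mem_center_iff.1 (htop ▸ Subring.mem_top x : x ∈ Subring.center D)) y).symm
  -- Jacobson–Noether gives a noncentral separable element, but pure inseparability over the center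
  -- forces separable elements to be central.
  obtain ⟨z, hz, hs⟩ := JacobsonNoether.exists_separable_and_not_isCentral D hne
  obtain ⟨c, rfl⟩ := IsPurelyInseparable.inseparable (Subring.center D) z hs
  exact hz c.2

variable {F : Type u} [Field F] (q : ℕ) [ExpChar F q]
  {C : Type v} [Ring C] [Algebra F C] [FiniteDimensional F C]

include q in
/-- If all separable elements of `C` are central, then `C` is commutative modulo its radical. -/
theorem mul_sub_mul_mem_jacobson (hsep : ∀ s : C, IsSeparable F s → s ∈ Subring.center C)
    (x y : C) : x * y - y * x ∈ Ring.jacobson C := by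
  have : IsArtinianRing C := .of_finite F C
  let π : C →+* C ⧸ Ring.jacobson C := Ideal.Quotient.mk _
  obtain ⟨n, D, d, _, hd, ⟨e⟩⟩ :=
    IsSemisimpleRing.exists_ringEquiv_pi_matrix_divisionRing (C ⧸ Ring.jacobson C)
  have hπ : Function.Surjective π := Ideal.Quotient.mk_surjective
  have hnil (z : C) (hz : z ∈ RingHom.ker π) : IsNilpotent z := by
    obtain ⟨k, hk⟩ := IsSemiprimaryRing.isNilpotent (R := C)
    refine ⟨k, ?_⟩
    rw [Ideal.mk_ker] at hz
    have := Ideal.pow_mem_pow hz k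
    rw [hk] at this
    simpa using this
  -- Idempotents lift modulo the nilpotent radical, and an idempotent is separable as a root of `X *
  -- (X - 1)`; hence all idempotents of the quotient are central.
  have hidem (z : C ⧸ Ring.jacobson C) (hz : IsIdempotentElem z) (w) : z * w = w * z := by
    obtain ⟨z', hz', rfl⟩ := exists_isIdempotentElem_eq_of_ker_isNilpotent π hnil z (hπ z) hz
    obtain ⟨w, rfl⟩ := hπ w
    have : IsSeparable F z' := by
      have hdvd : minpoly F z' ∣ Polynomial.X * (Polynomial.X - 1) := minpoly.dvd F _ (by
        rw [map_mul, map_sub, Polynomial.aeval_X, map_one, mul_sub, mul_one, hz'.eq, sub_self])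
      refine Polynomial.Separable.of_dvd ?_ hdvd
      have h1 : (Polynomial.X - 1 : Polynomial F) = Polynomial.X - Polynomial.C 1 := by simp
      rw [h1]
      refine Polynomial.separable_X.mul Polynomial.separable_X_sub_C ⟨1, -1, by simp⟩
    rw [← map_mul, ← map_mul, Subring.mem_center_iff.1 (hsep z' this) w]
  -- A matrix block of size at least two has the noncentral idempotent `e_aa`, which fails to
  -- commute with `e_ab`.
  have hd1 (i) : Subsingleton (Fin (d i)) := by
    refine ⟨fun a b => ?_⟩
    by_contra hab
    have h1 := hidem (e.symm (Pi.single i (Matrix.single a a 1))) (by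
      apply e.injective
      rw [map_mul, e.apply_symm_apply, ← Pi.single_mul, Matrix.single_mul_single_same, mul_one])
      (e.symm (Pi.single i (Matrix.single a b 1)))
    have h2 := congrFun (congrArg e h1) i
    rw [map_mul, map_mul, e.apply_symm_apply, e.apply_symm_apply, ← Pi.single_mul, ← Pi.single_mul,
      Pi.single_eq_same, Pi.single_eq_same, Matrix.single_mul_single_same,
      Matrix.single_mul_single_of_ne _ _ _ _ (Ne.symm hab)] at h2
    have h3 := congrFun (congrFun h2 a) b
    simp at h3
  have hi0 (i) : Fin (d i) := ⟨0, Nat.pos_of_ne_zero (hd i).out⟩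
  let ψ (i) : C → D i := fun z => e (π z) i (hi0 i) (hi0 i)
  have hψmul (i) (z w : C) : ψ i (z * w) = ψ i z * ψ i w := by
    simp only [ψ, map_mul, Pi.mul_apply, Matrix.mul_apply]
    rw [Fintype.sum_subsingleton _ (hi0 i)]
  let Ψ (i) : C →+* D i :=
    { toFun := ψ i
      map_mul' := hψmul i
      map_one' := by simp [ψ]
      map_zero' := by simp [ψ]
      map_add' := by simp [ψ] }
  have hΨ (i) : Function.Surjective (Ψ i) := by
    intro z
    obtain ⟨w, hw⟩ := hπ (e.symm (Pi.single i (Matrix.single (hi0 i) (hi0 i) z)))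
    refine ⟨w, ?_⟩
    change e (π w) i _ _ = _
    rw [hw, e.apply_symm_apply]
    simp
  -- In a division ring nilpotents vanish, so a `q`-power of each element is the image of a
  -- separable, hence central, element.
  have hcomm (i) (z w : D i) : z * w = w * z := by
    have : ExpChar (D i) q :=
      expChar_of_injective_ringHom ((Ψ i).comp (algebraMap F C)).injective q
    refine mul_comm_of_pow_mem_center (D i) q (fun z => ?_) z w
    obtain ⟨z, rfl⟩ := hΨ i z
    obtain ⟨m, s, hs, hn⟩ := exists_isNilpotent_pow_sub (F := F) q z
    refine ⟨m, ?_⟩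
    have h0 : Ψ i z ^ q ^ m = Ψ i s := by
      have := (hn.map (Ψ i)).eq_zero
      rw [map_sub, map_pow, sub_eq_zero] at this
      exact this
    rw [h0, Subring.mem_center_iff]
    intro w
    obtain ⟨w, rfl⟩ := hΨ i w
    rw [← map_mul, ← map_mul, Subring.mem_center_iff.1 (hsep s hs) w]
  rw [← Ideal.mk_ker (I := Ring.jacobson C), RingHom.mem_ker, map_sub, sub_eq_zero]
  apply e.injective
  funext i
  ext a b
  rw [Subsingleton.elim a (hi0 i), Subsingleton.elim b (hi0 i)]
  change ψ i (x * y) = ψ i (y * x)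
  rw [hψmul, hψmul, hcomm]

/-- If all separable elements of `C` are central, then some `q`-power of every element is congruent
to a separable element modulo the radical. -/
theorem exists_pow_sub_mem_jacobson (hsep : ∀ s : C, IsSeparable F s → s ∈ Subring.center C)
    (x : C) : ∃ (m : ℕ) (s : C), IsSeparable F s ∧ x ^ q ^ m - s ∈ Ring.jacobson C := by
  have : IsArtinianRing C := .of_finite F C
  obtain ⟨m, s, hs, hn⟩ := exists_isNilpotent_pow_sub (F := F) q x
  refine ⟨m, s, hs, ?_⟩
  let _ : CommRing (C ⧸ Ring.jacobson C) :=
    { (inferInstance : Ring (C ⧸ Ring.jacobson C)) with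
      mul_comm := fun a b => by
        obtain ⟨a, rfl⟩ := Ideal.Quotient.mk_surjective a
        obtain ⟨b, rfl⟩ := Ideal.Quotient.mk_surjective b
        rw [← map_mul, ← map_mul, ← sub_eq_zero, ← map_sub, Ideal.Quotient.eq_zero_iff_mem]
        exact mul_sub_mul_mem_jacobson q hsep a b }
  have : IsReduced (C ⧸ Ring.jacobson C) := inferInstance
  have := (hn.map (Ideal.Quotient.mk (Ring.jacobson C))).eq_zero
  rwa [Ideal.Quotient.eq_zero_iff_mem] at this

end Radical

/-! ### Base change modulo the radical, and locality of idempotents -/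

section BaseChangeRadical

variable {F : Type*} [Field F] {C : Type*} [Ring C] [Algebra F C]
  (Ω : Type*) [Field Ω] [Algebra F Ω]

/-- The span of the pure tensors `ω ⊗ c` with `c` in `I`. -/
def tensorIdeal (I : Ideal C) : Submodule F (Ω ⊗[F] C) :=
  Submodule.span F {t | ∃ ω : Ω, ∃ c ∈ I, t = ω ⊗ₜ[F] c}

theorem tensorIdeal_mul_le (I I' : Ideal C) :
    tensorIdeal (F := F) Ω I * tensorIdeal Ω I' ≤ tensorIdeal Ω (I * I') := by
  rw [tensorIdeal, tensorIdeal, Submodule.span_mul_span, Submodule.span_le]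
  rintro _ ⟨_, ⟨ω, c, hc, rfl⟩, _, ⟨ω', c', hc', rfl⟩, rfl⟩
  exact Submodule.subset_span ⟨ω * ω', c * c', Ideal.mul_mem_mul hc hc', by
    simp only [Algebra.TensorProduct.tmul_mul_tmul]⟩

theorem pow_mem_tensorIdeal {I : Ideal C} {x : Ω ⊗[F] C} (hx : x ∈ tensorIdeal (F := F) Ω I)
    (n : ℕ) : x ^ (n + 1) ∈ tensorIdeal (F := F) Ω (I ^ (n + 1)) := by
  induction n with
  | zero => simpa [Submodule.pow_one] using hx
  | succ n ih =>
    rw [pow_succ x, Submodule.pow_succ]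
    exact tensorIdeal_mul_le Ω _ _ (Submodule.mul_mem_mul ih hx)

theorem isNilpotent_of_mem_tensorIdeal {I : Ideal C} (hI : IsNilpotent I) {x : Ω ⊗[F] C}
    (hx : x ∈ tensorIdeal (F := F) Ω I) : IsNilpotent x := by
  obtain ⟨n, hn⟩ := hI
  refine ⟨n + 1, ?_⟩
  have h := pow_mem_tensorIdeal Ω hx n
  rw [Submodule.pow_succ, hn, Submodule.zero_eq_bot, Ideal.bot_mul] at h
  have hbot : tensorIdeal (F := F) Ω (⊥ : Ideal C) = ⊥ := by
    rw [tensorIdeal, Submodule.span_eq_bot]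
    rintro _ ⟨ω, c, hc, rfl⟩
    rw [show c = 0 from hc, TensorProduct.tmul_zero]
  rwa [hbot, Submodule.mem_bot] at h

/-- The kernel of a base changed surjection is nil if the original kernel is nilpotent. -/
theorem isNilpotent_of_map_eq_zero {S : Type*} [Ring S] [Algebra F S] (π : C →ₐ[F] S)
    (hπ : Function.Surjective π) (hker : IsNilpotent (RingHom.ker π)) (x : Ω ⊗[F] C)
    (hx : Algebra.TensorProduct.map (AlgHom.id Ω Ω) π x = 0) : IsNilpotent x := by
  refine isNilpotent_of_mem_tensorIdeal Ω hker ?_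
  -- By right exactness, `x` comes from `Ω ⊗ ker π`.
  have hex := lTensor_exact Ω π.toLinearMap.exact_subtype_ker_map hπ
  have hx' : LinearMap.lTensor Ω π.toLinearMap x = 0 := hx
  obtain ⟨z, rfl⟩ := (hex x).1 hx'
  clear hx hx'
  induction z with
  | zero => rw [map_zero]; exact Submodule.zero_mem _
  | add y z hy hz => rw [map_add]; exact Submodule.add_mem _ hy hz
  | tmul ω c => exact Submodule.subset_span ⟨ω, c, c.2, rfl⟩

/-- Frobenius is additive on the commutative ring `Ω ⊗ S`, so the property passes from pure tensors
to their sums. -/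
theorem exists_pow_mem_range_map {K S : Type*} [CommRing K] [Algebra F K] [CommRing S] [Algebra F S]
    (q : ℕ) [ExpChar F q] (κ : K →ₐ[F] S) (hκ : ∀ y : S, ∃ (m : ℕ) (k : K), y ^ q ^ m = κ k)
    (x : Ω ⊗[F] S) :
    ∃ (m : ℕ) (t : Ω ⊗[F] K), x ^ q ^ m = Algebra.TensorProduct.map (AlgHom.id Ω Ω) κ t := by
  cases subsingleton_or_nontrivial (Ω ⊗[F] S) with
  | inl h => exact ⟨0, 0, Subsingleton.elim _ _⟩
  | inr h =>
  have : ExpChar (Ω ⊗[F] S) q :=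
    expChar_of_injective_algebraMap (algebraMap F (Ω ⊗[F] S)).injective q
  induction x with
  | zero => exact ⟨0, 0, by simp⟩
  | tmul ω y =>
    obtain ⟨m, k, hk⟩ := hκ y
    exact ⟨m, (ω ^ q ^ m) ⊗ₜ k, by
      rw [Algebra.TensorProduct.tmul_pow, hk, Algebra.TensorProduct.map_tmul, AlgHom.id_apply]⟩
  | add x y hx hy =>
    obtain ⟨m, t, ht⟩ := hx
    obtain ⟨m', t', ht'⟩ := hy
    refine ⟨m + m', t ^ q ^ m' + t' ^ q ^ m, ?_⟩
    rw [add_pow_expChar_pow, map_add, map_pow, map_pow, ← ht, ← ht', ← pow_mul, ← pow_mul,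
      ← pow_add, ← pow_add, add_comm m' m]

/-- Let `K` be a central subalgebra of `C` over which `C` is purely inseparable modulo a nilpotent
ideal, and let `f` be an idempotent of `Ω ⊗ K` that generates a line. If `f` is a sum of
elements of the corner ring of `f` in `Ω ⊗ C`, one of the summands is invertible in that corner. -/
theorem exists_mul_eq_of_sum_eq {K S : Type*} [CommRing K] [Algebra F K] [CommRing S] [Algebra F S]
    (q : ℕ) [ExpChar F q] (j : K →ₐ[F] C) (hj : Function.Injective j)
    (π : C →ₐ[F] S) (hπ : Function.Surjective π) (hker : IsNilpotent (RingHom.ker π))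
    (hpow : ∀ y : S, ∃ (m : ℕ) (k : K), y ^ q ^ m = π (j k))
    {f : Ω ⊗[F] K} (hff : f * f = f) (hf0 : f ≠ 0) (hf : ∀ t, ∃ r : Ω, t * f = r • f)
    {ι : Type*} [Fintype ι] (x : ι → Ω ⊗[F] C)
    (hxg : ∀ i, x i * Algebra.TensorProduct.map (AlgHom.id Ω Ω) j f = x i)
    (hsum : ∑ i, x i = Algebra.TensorProduct.map (AlgHom.id Ω Ω) j f) :
    ∃ i w, w * x i = Algebra.TensorProduct.map (AlgHom.id Ω Ω) j f := by
  set g := Algebra.TensorProduct.map (AlgHom.id Ω Ω) j f with hg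
  let p := Algebra.TensorProduct.map (AlgHom.id Ω Ω) π
  have hgg : g * g = g := by rw [hg, ← map_mul, hff]
  have hg0 : g ≠ 0 := by
    have hinj : Function.Injective (LinearMap.lTensor Ω j.toLinearMap) :=
      Module.Flat.lTensor_preserves_injective_linearMap _ hj
    intro h0
    exact hf0 (hinj (h0.trans (map_zero _).symm))
  have hidem (n : ℕ) : g ^ (n + 1) = g := by
    induction n with
    | zero => simp
    | succ n ih => rw [pow_succ, ih, hgg]
  have hgnil : ¬ IsNilpotent g := by
    rintro ⟨n, hn⟩
    exact hg0 (by rw [← hidem n, pow_succ, hn, zero_mul])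
  have hpg : ¬ IsNilpotent (p g) := by
    rintro ⟨n, hn⟩
    apply hgnil
    apply isNilpotent_of_map_eq_zero Ω π hπ hker
    change p g = 0
    rw [← hidem n, map_pow, pow_succ, hn, zero_mul]
  -- The image of `g` is not nilpotent, and in the commutative ring `Ω ⊗ S` a sum of nilpotents is
  -- nilpotent.
  obtain ⟨i, hi⟩ : ∃ i, ¬ IsNilpotent (p (x i)) := by
    by_contra! hall
    apply hpg
    rw [← hsum, map_sum]
    exact isNilpotent_sum fun i _ => hall i
  obtain ⟨m, t, ht⟩ := exists_pow_mem_range_map Ω q (π.comp j) hpow (p (x i))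
  obtain ⟨r, hr⟩ := hf t
  have hq : 0 < q ^ m := pow_pos (expChar_pos F q) m
  -- Writing the exponent as `Q + 1` leaves a factor `x i` to split off when forming the left
  -- inverse.
  obtain ⟨Q, hQ⟩ : ∃ Q, q ^ m = Q + 1 := ⟨q ^ m - 1, by omega⟩
  have hpt (s : Ω ⊗[F] K) : Algebra.TensorProduct.map (AlgHom.id Ω Ω) (π.comp j) s =
      p (Algebra.TensorProduct.map (AlgHom.id Ω Ω) j s) := by
    induction s with
    | zero => simp
    | add x y hx hy => simp only [map_add, hx, hy]
    | tmul ω k => simp [p]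
  have hxQ : x i ^ (Q + 1) * g = x i ^ (Q + 1) := by rw [pow_succ, mul_assoc, hxg]
  have hpx : p (x i ^ (Q + 1)) = p (r • g) := by
    rw [← hxQ, map_mul, map_pow, ← hQ, ht, hpt, ← map_mul, hg, ← map_mul, hr, map_smul]
  have hr0 : r ≠ 0 := by
    rintro rfl
    apply hi
    exact ⟨Q + 1, by rw [← map_pow, hpx, zero_smul, map_zero]⟩
  -- Modulo nilpotents the power of `x i` is `r • g` with `r ≠ 0`; thus `z` is nilpotent and `(1 +
  -- z) * g` is a scalar multiple of that power.
  let z := r⁻¹ • x i ^ (Q + 1) - g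
  have hz : IsNilpotent z := by
    apply isNilpotent_of_map_eq_zero Ω π hπ hker
    change p (r⁻¹ • x i ^ (Q + 1) - g) = 0
    rw [map_sub, map_smul, hpx, map_smul, smul_smul, inv_mul_cancel₀ hr0, one_smul, sub_self]
  obtain ⟨w, hw⟩ := hz.isUnit_one_add.exists_left_inv
  refine ⟨i, w * (r⁻¹ • x i ^ Q), ?_⟩
  have hzg : (1 + z) * g = r⁻¹ • x i ^ (Q + 1) := by
    rw [add_mul, one_mul, sub_mul, smul_mul_assoc, hxQ, hgg]
    abel
  rw [mul_assoc, smul_mul_assoc, ← pow_succ, ← hzg, ← mul_assoc, hw, one_mul]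

end BaseChangeRadical

/-! ### Equivalence of idempotents -/

section Idempotents

/-- If an idempotent `f` is "local" relative to a complete system of orthogonal idempotents `e i`
with trivial corners, then `f` is equivalent to some `e i`. -/
theorem exists_equivalent_idempotent {Ω M : Type*} [Field Ω] [Ring M] [Algebra Ω M] {ι : Type*}
    [Fintype ι] {e : ι → M} (hee : ∀ i, e i * e i = e i)
    (hcorner : ∀ i x, ∃ r : Ω, e i * x * e i = r • e i) {f : M} (hff : f * f = f) (hf0 : f ≠ 0)
    (hloc : ∃ i w, w * (f * e i * f) = f) :
    ∃ i a b, a * b = f ∧ b * a = e i := by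
  obtain ⟨i, w, hw⟩ := hloc
  refine ⟨i, f * w * f * e i, e i * f, ?_, ?_⟩
  · calc f * w * f * e i * (e i * f) = f * (w * (f * (e i * e i) * f)) := by noncomm_ring
      _ = f := by rw [hee, hw, hff]
  · have hab : (f * w * f * e i) * (e i * f) = f := by
      calc f * w * f * e i * (e i * f) = f * (w * (f * (e i * e i) * f)) := by noncomm_ring
        _ = f := by rw [hee, hw, hff]
    -- Since `a * b = f`, the product `b * a` is an idempotent of the line spanned by `e i`; it is
    -- nonzero because `f` is, so it equals `e i`.
    obtain ⟨r, hr⟩ := hcorner i (f * (f * w * f))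
    have hba : e i * f * (f * w * f * e i) = r • e i := by rw [← hr]; noncomm_ring
    have hsq : (r * r) • e i = r • e i := by
      have h1 : (r • e i) * (r • e i) = (r * r) • e i := by
        rw [smul_mul_assoc, mul_smul_comm, hee, smul_smul]
      rw [← h1, ← hba]
      calc e i * f * (f * w * f * e i) * (e i * f * (f * w * f * e i))
          = e i * f * ((f * w * f * e i) * (e i * f)) * (f * w * f * e i) := by noncomm_ring
        _ = e i * (f * f) * (f * w * f * e i) := by rw [hab]; noncomm_ring
        _ = _ := by rw [hff]
    have hr0 : r ≠ 0 := by
      rintro rfl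
      apply hf0
      calc f = f * f := hff.symm
        _ = (f * w * f * e i) * (e i * f * (f * w * f * e i)) * (e i * f) := by
            conv_lhs => rw [← hab]
            noncomm_ring
        _ = 0 := by rw [hba, zero_smul, mul_zero, zero_mul]
    rw [hba]
    calc r • e i = r⁻¹ • ((r * r) • e i) := by
          rw [smul_smul, ← mul_assoc, inv_mul_cancel₀ hr0, one_mul]
      _ = e i := by rw [hsq, smul_smul, inv_mul_cancel₀ hr0, one_smul]

end Idempotents

/-! ### Slicing tensors by functionals -/

section Slices

variable {F : Type*} [Field F] {Ω : Type*} [Field Ω] [Algebra F Ω]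
  {V : Type*} [AddCommGroup V] [Module F V]

/-- Apply a linear functional to the left factor of a tensor. -/
noncomputable def slice (φ : Ω →ₗ[F] F) : Ω ⊗[F] V →ₗ[F] V :=
  (TensorProduct.lid F V).toLinearMap ∘ₗ LinearMap.rTensor V φ

theorem slice_tmul (φ : Ω →ₗ[F] F) (ω : Ω) (v : V) : slice φ (ω ⊗ₜ v) = φ ω • v := by
  simp [slice]

/-- The coordinates of `x` along a basis of `Ω` over `F` are slices by the coordinate functionals.
Subspaces cut out by conditions that commute with slicing therefore commute with base change. -/
theorem exists_lTensor_subtype_eq (U : Submodule F V) (x : Ω ⊗[F] V)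
    (hx : ∀ φ : Ω →ₗ[F] F, slice φ x ∈ U) : ∃ z : Ω ⊗[F] U, LinearMap.lTensor Ω U.subtype z = x := by
  classical
  let b := Module.Free.chooseBasis F Ω
  let Φ := TensorProduct.equivFinsuppOfBasisLeft (N := V) b
  have hΦ (i) (x : Ω ⊗[F] V) : Φ x i = slice (b.coord i) x := by
    induction x with
    | zero => simp
    | add x y hx hy => rw [map_add, Finsupp.add_apply, hx, hy, map_add]
    | tmul ω v => rw [slice_tmul]; simp [Φ]
  have hx' : x = (Φ x).sum fun i v => b i ⊗ₜ v := by
    conv_lhs => rw [← Φ.symm_apply_apply x]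
    exact TensorProduct.equivFinsuppOfBasisLeft_symm_apply b (Φ x)
  refine ⟨(Φ x).sum fun i v => b i ⊗ₜ[F] (if h : v ∈ U then ⟨v, h⟩ else 0), ?_⟩
  conv_rhs => rw [hx']
  rw [Finsupp.sum, Finsupp.sum, map_sum]
  refine Finset.sum_congr rfl fun i _ => ?_
  have : Φ x i ∈ U := by rw [hΦ]; exact hx _
  rw [dif_pos this, LinearMap.lTensor_tmul, Submodule.subtype_apply]

variable {A : Type*} [NonAssocRing A] [Module F A] [SMulCommClass F A A] [IsScalarTower F A A]

theorem slice_mul_one_tmul (φ : Ω →ₗ[F] F) (x : Ω ⊗[F] A) (a : A) :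
    slice φ (x * (1 ⊗ₜ a)) = slice φ x * a := by
  induction x with
  | zero => simp
  | add x y hx hy => rw [add_mul, map_add, map_add, hx, hy, add_mul]
  | tmul ω v =>
    rw [Algebra.TensorProduct.tmul_mul_tmul, slice_tmul, slice_tmul, mul_one, smul_mul_assoc]

theorem slice_one_tmul_mul (φ : Ω →ₗ[F] F) (x : Ω ⊗[F] A) (a : A) :
    slice φ ((1 ⊗ₜ a) * x) = a * slice φ x := by
  induction x with
  | zero => simp
  | add x y hx hy => rw [mul_add, map_add, map_add, hx, hy, mul_add]
  | tmul ω v =>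
    rw [Algebra.TensorProduct.tmul_mul_tmul, slice_tmul, slice_tmul, one_mul, mul_smul_comm]

end Slices

/-! ### The nucleus commutes with base change -/

section NucleusBaseChange

variable {F : Type u} [Field F] {A : Type v} [NonAssocRing A] [Module F A]
  [SMulCommClass F A A] [IsScalarTower F A A] {Ω : Type w} [Field Ω] [Algebra F Ω]

/-- The nuclear identities against `1 ⊗ a` and `1 ⊗ b` pass through a slice, which commutes with
multiplication by such tensors on either side. -/
theorem slice_mem_nucleus {x : Ω ⊗[F] A} (hx : x ∈ nucleus Ω (Ω ⊗[F] A)) (φ : Ω →ₗ[F] F) :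
    slice φ x ∈ nucleus F A := by
  have h1 (a b : A) : (1 : Ω) ⊗ₜ[F] (a * b) = (1 ⊗ₜ a) * (1 ⊗ₜ b) := by
    rw [Algebra.TensorProduct.tmul_mul_tmul, mul_one]
  rw [mem_nucleus_iff]
  refine ⟨fun a b => ?_, fun a b => ?_, fun a b => ?_⟩
  · rw [← slice_mul_one_tmul, ← slice_mul_one_tmul, ← slice_mul_one_tmul, left_assoc hx, h1]
  · rw [← slice_one_tmul_mul, ← slice_mul_one_tmul, ← slice_mul_one_tmul, ← slice_one_tmul_mul,
      mid_assoc hx]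
  · rw [← slice_one_tmul_mul, ← slice_one_tmul_mul, ← slice_one_tmul_mul, ← right_assoc hx, h1]

theorem one_tmul_mem_nucleus {x : A} (hx : x ∈ nucleus F A) :
    (1 : Ω) ⊗ₜ[F] x ∈ nucleus Ω (Ω ⊗[F] A) := by
  rw [mem_nucleus_iff]
  refine ⟨fun a b => ?_, fun a b => ?_, fun a b => ?_⟩
  all_goals
    induction a with
    | zero => simp
    | add a a' ha ha' => simp only [mul_add, add_mul, ha, ha']
    | tmul ω a =>
      induction b with
      | zero => simp
      | add b b' hb hb' => simp only [mul_add, hb, hb', add_mul]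
      | tmul ω' b =>
        simp only [Algebra.TensorProduct.tmul_mul_tmul, one_mul, mul_one, left_assoc hx,
          mid_assoc hx, right_assoc hx]

variable (F A Ω) in
/-- The base change of the inclusion of the nucleus. -/
noncomputable def nucleusMap : Ω ⊗[F] nucleus F A →ₗ[Ω] Ω ⊗[F] A :=
  LinearMap.baseChange Ω (nucleus F A).subtype

theorem nucleusMap_tmul (ω : Ω) (x : nucleus F A) :
    nucleusMap F A Ω (ω ⊗ₜ x) = ω ⊗ₜ (x : A) := rfl

theorem nucleusMap_one : nucleusMap F A Ω 1 = 1 := rfl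

theorem nucleusMap_mul (x y : Ω ⊗[F] nucleus F A) :
    nucleusMap F A Ω (x * y) = nucleusMap F A Ω x * nucleusMap F A Ω y := by
  induction x with
  | zero => simp
  | add x x' hx hx' => simp only [add_mul, map_add, hx, hx']
  | tmul ω x =>
    induction y with
    | zero => simp
    | add y y' hy hy' => simp only [mul_add, map_add, hy, hy']
    | tmul ω' y =>
      simp only [Algebra.TensorProduct.tmul_mul_tmul, nucleusMap_tmul, nucleus_coe_mul]

theorem nucleusMap_injective : Function.Injective (nucleusMap F A Ω) :=
  Module.Flat.lTensor_preserves_injective_linearMap (M := Ω) (nucleus F A).subtype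
    (nucleus F A).injective_subtype

theorem nucleusMap_mem (x : Ω ⊗[F] nucleus F A) :
    nucleusMap F A Ω x ∈ nucleus Ω (Ω ⊗[F] A) := by
  induction x with
  | zero => rw [map_zero]; exact Submodule.zero_mem _
  | add x y hx hy => rw [map_add]; exact Submodule.add_mem _ hx hy
  | tmul ω x =>
    have : ω ⊗ₜ[F] x = ω • ((1 : Ω) ⊗ₜ[F] x) := by
      rw [TensorProduct.smul_tmul', smul_eq_mul, mul_one]
    rw [this, map_smul, nucleusMap_tmul]
    exact Submodule.smul_mem _ _ (one_tmul_mem_nucleus x.2)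

theorem exists_nucleusMap_eq {x : Ω ⊗[F] A} (hx : x ∈ nucleus Ω (Ω ⊗[F] A)) :
    ∃ z, nucleusMap F A Ω z = x :=
  exists_lTensor_subtype_eq (nucleus F A) x fun φ => slice_mem_nucleus hx φ

end NucleusBaseChange

/-! ### Idempotents of a maximal étale subalgebra stay local -/

section LocalIdempotents

variable {F : Type u} [Field F] {N : Type v} [Ring N] [Algebra F N]

theorem exists_map_centralizer_eq {Ω : Type w} [Field Ω] [Algebra F Ω] (K : Subalgebra F N)
    (x : Ω ⊗[F] N) (hx : ∀ k ∈ K, (1 ⊗ₜ k) * x = x * (1 ⊗ₜ k)) :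
    ∃ z : Ω ⊗[F] Subalgebra.centralizer F (K : Set N),
      Algebra.TensorProduct.map (AlgHom.id Ω Ω) (Subalgebra.centralizer F (K : Set N)).val z = x :=
  exists_lTensor_subtype_eq (Subalgebra.centralizer F (K : Set N)).toSubmodule x fun φ => by
    refine Subalgebra.mem_centralizer_iff F |>.2 fun k hk => ?_
    rw [← slice_one_tmul_mul, hx k hk, slice_mul_one_tmul]

-- Each `1 ⊗ k` acts on `g` by a scalar, the same from both sides, so the corner of `g` lies in `Ω ⊗
-- C` with `C` the centralizer of `K`. There `exists_mul_eq_of_sum_eq` applies to `g = ∑ g * e i *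
-- g`.
open scoped IsMulCommutative in
theorem exists_mul_corner_eq [FiniteDimensional F N] (K : Subalgebra F N) [IsMulCommutative K]
    (hmax : ∀ y, (∀ k ∈ K, k * y = y * k) → IsSeparable F y → y ∈ K)
    {Ω : Type w} [Field Ω] [Algebra F Ω] {f : Ω ⊗[F] K} (hff : f * f = f) (hf0 : f ≠ 0)
    (hf : ∀ t, ∃ r : Ω, t * f = r • f) {ι : Type*} [Fintype ι] (e : ι → Ω ⊗[F] N)
    (he : ∑ i, e i = 1) (g : Ω ⊗[F] N)
    (hg : g = Algebra.TensorProduct.map (AlgHom.id Ω Ω) K.val f) :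
    ∃ i w, w * (g * e i * g) = g := by
  obtain ⟨q, hq⟩ := ExpChar.exists F
  let C := Subalgebra.centralizer F (K : Set N)
  have hKC : K ≤ C := fun k hk => Subalgebra.mem_centralizer_iff F |>.2 fun l hl =>
    congrArg Subtype.val (mul_comm' (⟨l, hl⟩ : K) ⟨k, hk⟩)
  let j : K →ₐ[F] C := Subalgebra.inclusion hKC
  -- The minimal polynomial is the same in `C` and in `N`, so the maximality of `K` applies.
  have hsepK (s : C) (hs : IsSeparable F s) : (s : N) ∈ K := by
    refine hmax s (fun k hk => Subalgebra.mem_centralizer_iff F |>.1 s.2 k hk) ?_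
    have := minpoly.algHom_eq C.val Subtype.val_injective s
    rw [IsSeparable] at hs ⊢
    rwa [← this] at hs
  have hsep (s : C) (hs : IsSeparable F s) : s ∈ Subring.center C := by
    rw [Subring.mem_center_iff]
    intro y
    exact Subtype.ext (Subalgebra.mem_centralizer_iff F |>.1 y.2 s (hsepK s hs)).symm
  have : IsArtinianRing C := .of_finite F C
  let _ : CommRing (C ⧸ Ring.jacobson C) :=
    { (inferInstance : Ring (C ⧸ Ring.jacobson C)) with
      mul_comm := fun a b => by
        obtain ⟨a, rfl⟩ := Ideal.Quotient.mk_surjective a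
        obtain ⟨b, rfl⟩ := Ideal.Quotient.mk_surjective b
        rw [← map_mul, ← map_mul, ← sub_eq_zero, ← map_sub, Ideal.Quotient.eq_zero_iff_mem]
        exact mul_sub_mul_mem_jacobson q hsep a b }
  let π : C →ₐ[F] C ⧸ Ring.jacobson C := Ideal.Quotient.mkₐ F _
  have hπ : Function.Surjective π := Ideal.Quotient.mk_surjective
  have hker : IsNilpotent (RingHom.ker π) := by
    have : RingHom.ker π = Ring.jacobson C := Ideal.mk_ker
    rw [this]
    exact IsSemiprimaryRing.isNilpotent
  have hpow (y : C ⧸ Ring.jacobson C) : ∃ (m : ℕ) (k : K), y ^ q ^ m = π (j k) := by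
    obtain ⟨y, rfl⟩ := hπ y
    obtain ⟨m, s, hs, hmem⟩ := exists_pow_sub_mem_jacobson q hsep y
    refine ⟨m, ⟨s, hsepK s hs⟩, ?_⟩
    rw [← map_pow, ← sub_eq_zero, ← map_sub]
    exact Ideal.Quotient.eq_zero_iff_mem.2 hmem
  let ζ : Ω ⊗[F] C →ₐ[Ω] Ω ⊗[F] N := Algebra.TensorProduct.map (AlgHom.id Ω Ω) C.val
  have hζ : Function.Injective ζ :=
    Module.Flat.lTensor_preserves_injective_linearMap (M := Ω) C.val.toLinearMap
      Subtype.val_injective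
  have hζj (t : Ω ⊗[F] K) : ζ (Algebra.TensorProduct.map (AlgHom.id Ω Ω) j t) =
      Algebra.TensorProduct.map (AlgHom.id Ω Ω) K.val t := by
    induction t with
    | zero => simp
    | add x y hx hy => simp only [map_add, hx, hy]
    | tmul ω k => simp [ζ, j]
  have hgg : g * g = g := by rw [hg, ← map_mul, hff]
  have hkg (k) (hk : k ∈ K) : ∃ r : Ω, (1 ⊗ₜ k) * g = r • g ∧ g * (1 ⊗ₜ k) = r • g := by
    obtain ⟨r, hr⟩ := hf (1 ⊗ₜ ⟨k, hk⟩)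
    have h1 : (1 : Ω) ⊗ₜ[F] k = Algebra.TensorProduct.map (AlgHom.id Ω Ω) K.val
      (1 ⊗ₜ ⟨k, hk⟩) := by simp
    refine ⟨r, ?_, ?_⟩
    · rw [h1, hg, ← map_mul, hr, map_smul]
    · rw [h1, hg, ← map_mul, mul_comm, hr, map_smul]
  have hx (i) : ∃ z, ζ z = g * e i * g := by
    refine exists_map_centralizer_eq K _ fun k hk => ?_
    obtain ⟨r, h1, h2⟩ := hkg k hk
    rw [mul_assoc (g * e i), h2, ← mul_assoc, ← mul_assoc, h1, smul_mul_assoc, smul_mul_assoc,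
      mul_smul_comm]
  choose x hx using hx
  obtain ⟨i, w, hw⟩ := exists_mul_eq_of_sum_eq Ω q j (Subalgebra.inclusion_injective hKC) π hπ hker
    hpow hff hf0 hf x
    (fun i => hζ (by rw [map_mul, hζj, ← hg, hx, mul_assoc, hgg]))
    (hζ (by
      rw [map_sum, hζj, ← hg]
      simp_rw [hx, ← Finset.sum_mul, ← Finset.mul_sum, he, mul_one, hgg]))
  refine ⟨i, ζ w, ?_⟩
  rw [← hx, ← map_mul, hw, hζj, hg]

end LocalIdempotents

/-! ### Idempotents from a splitting of `K` -/

section SplitIdempotents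

open scoped IsMulCommutative

variable {F : Type u} [Field F] {A : Type v} [NonAssocRing A] [Module F A]
  [SMulCommClass F A A] [IsScalarTower F A A] {Ω : Type w} [Field Ω] [Algebra F Ω]

section CommRing

variable {K : Type*} [CommRing K] [Algebra F K] {n : ℕ} (e : Ω ⊗[F] K ≃ₐ[Ω] (Fin n → Ω))

/-- The primitive idempotents of a split algebra. -/
noncomputable def splitIdem (i : Fin n) : Ω ⊗[F] K := e.symm (Pi.single i 1)

theorem mul_splitIdem (t : Ω ⊗[F] K) (i : Fin n) : t * splitIdem e i = e t i • splitIdem e i := by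
  apply e.injective
  rw [map_mul, map_smul, splitIdem, e.apply_symm_apply]
  funext j
  by_cases h : j = i
  · subst h; simp
  · simp [h]

theorem apply_splitIdem_self (i : Fin n) : e (splitIdem e i) i = 1 := by
  rw [splitIdem, e.apply_symm_apply, Pi.single_eq_same]

theorem splitIdem_mul_self (i : Fin n) : splitIdem e i * splitIdem e i = splitIdem e i := by
  rw [mul_splitIdem, apply_splitIdem_self, one_smul]

theorem splitIdem_mul_of_ne {i j : Fin n} (h : i ≠ j) : splitIdem e i * splitIdem e j = 0 := by
  rw [mul_splitIdem]
  conv_lhs => enter [1]; rw [splitIdem, e.apply_symm_apply, Pi.single_eq_of_ne h.symm]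
  rw [zero_smul]

theorem splitIdem_ne_zero (i : Fin n) : splitIdem e i ≠ 0 := fun h => by
  have := apply_splitIdem_self e i
  rw [h, map_zero] at this
  exact zero_ne_one this

theorem sum_splitIdem : ∑ i, splitIdem e i = 1 := by
  simp_rw [splitIdem, ← map_sum]
  rw [Finset.univ_sum_single (fun _ : Fin n => (1 : Ω))]
  exact map_one e.symm

include e in
theorem finrank_of_split : Module.finrank F K = n := by
  rw [← Module.finrank_baseChange (R := Ω), e.toLinearEquiv.finrank_eq, Module.finrank_fin_fun]

/-- The products of two characters of a split algebra separate the elements of `K ⊗ K`. -/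
theorem eq_zero_of_forall_char (t : K ⊗[F] K)
    (Λ : Fin n → Fin n → K ⊗[F] K →ₗ[F] Ω)
    (hΛ : ∀ i j k k', Λ i j (k ⊗ₜ k') = e (1 ⊗ₜ k) i * e (1 ⊗ₜ k') j)
    (ht : ∀ i j, Λ i j t = 0) : t = 0 := by
  let σ (i : Fin n) : K →ₗ[F] Ω := (LinearMap.proj i ∘ₗ e.toLinearMap).restrictScalars F ∘ₗ
    (TensorProduct.mk F Ω K 1)
  have hσ (i) (k : K) : σ i k = e (1 ⊗ₜ k) i := rfl
  have hinj (k : K) (hk : ∀ i, σ i k = 0) : k = 0 := by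
    have h1 : (1 : Ω) ⊗ₜ[F] k = 0 := e.injective (by rw [map_zero]; exact funext hk)
    exact Algebra.TensorProduct.includeRight_injective (A := Ω) (algebraMap F Ω).injective
      (h1.trans (map_zero (Algebra.TensorProduct.includeRight (R := F) (A := Ω) (B := K))).symm)
  -- The characters are used one factor at a time: first on the right factor, through `e`, then on
  -- the coefficients in the left factor along a basis of the right one.
  have h1 (i) : LinearMap.rTensor K (σ i) t = 0 := by
    apply e.injective
    rw [map_zero]
    funext j
    refine Eq.trans ?_ (ht i j)
    clear ht
    induction t with
    | zero => simp
    | add x y hx hy => rw [map_add, map_add, map_add, Pi.add_apply, hx, hy]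
    | tmul k k' =>
      have : σ i k ⊗ₜ[F] k' = σ i k • ((1 : Ω) ⊗ₜ[F] k') := by
        rw [TensorProduct.smul_tmul', smul_eq_mul, mul_one]
      rw [LinearMap.rTensor_tmul, this, map_smul, Pi.smul_apply, smul_eq_mul, hΛ, hσ]
  let b := Module.Free.chooseBasis F K
  apply (TensorProduct.equivFinsuppOfBasisRight (M := K) b).injective
  rw [map_zero]
  ext l
  rw [TensorProduct.equivFinsuppOfBasisRight_apply, Finsupp.zero_apply]
  apply hinj
  intro i
  have h2 := congrArg (TensorProduct.rid F Ω ∘ LinearMap.lTensor Ω (b.coord l)) (h1 i)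
  rw [Function.comp_apply, Function.comp_apply, map_zero, map_zero] at h2
  rw [← h2]
  clear h1 h2 ht
  induction t with
  | zero => simp
  | add x y hx hy => simp only [map_add, hx, hy]
  | tmul k k' => simp

end CommRing

variable {K : Subalgebra F (nucleus F A)} [IsMulCommutative K] {n : ℕ}
  (e : Ω ⊗[F] K ≃ₐ[Ω] (Fin n → Ω))

/-- The idempotents of `Ω ⊗ A` obtained from a splitting of a commutative subalgebra of the
nucleus. -/
noncomputable def nuclearIdem (i : Fin n) : Ω ⊗[F] A :=
  nucleusMap F A Ω (Algebra.TensorProduct.map (AlgHom.id Ω Ω) K.val (splitIdem e i))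

theorem nuclearIdem_mul (i : Fin n) (k : K) :
    nuclearIdem e i * (1 ⊗ₜ ((k : nucleus F A) : A)) = e (1 ⊗ₜ k) i • nuclearIdem e i := by
  have h1 : (1 : Ω) ⊗ₜ[F] ((k : nucleus F A) : A) =
      nucleusMap F A Ω (Algebra.TensorProduct.map (AlgHom.id Ω Ω) K.val (1 ⊗ₜ k)) := rfl
  rw [h1, nuclearIdem, ← nucleusMap_mul, ← map_mul, mul_comm, mul_splitIdem, map_smul, map_smul]

theorem mul_nuclearIdem (i : Fin n) (k : K) :
    (1 ⊗ₜ ((k : nucleus F A) : A)) * nuclearIdem e i = e (1 ⊗ₜ k) i • nuclearIdem e i := by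
  have h1 : (1 : Ω) ⊗ₜ[F] ((k : nucleus F A) : A) =
      nucleusMap F A Ω (Algebra.TensorProduct.map (AlgHom.id Ω Ω) K.val (1 ⊗ₜ k)) := rfl
  rw [h1, nuclearIdem, ← nucleusMap_mul, ← map_mul, mul_splitIdem, map_smul, map_smul]

theorem isNuclearDecomposition_nuclearIdem : IsNuclearDecomposition Ω (nuclearIdem e) where
  mem_nucleus i := nucleusMap_mem _
  mul_self i := by
    rw [nuclearIdem, ← nucleusMap_mul, ← map_mul, splitIdem_mul_self]
  mul_of_ne i j hij := by
    rw [nuclearIdem, nuclearIdem, ← nucleusMap_mul, ← map_mul, splitIdem_mul_of_ne e hij, map_zero,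
      map_zero]
  sum_eq := by
    simp_rw [nuclearIdem, ← map_sum]
    rw [sum_splitIdem, map_one, nucleusMap_one]

theorem nuclearIdem_biAction (i j : Fin n) (k k' : K) (a : A) :
    nuclearIdem e i * (1 ⊗ₜ biAction K (k ⊗ₜ k') a) * nuclearIdem e j =
      (e (1 ⊗ₜ k) i * e (1 ⊗ₜ k') j) • (nuclearIdem e i * (1 ⊗ₜ a) * nuclearIdem e j) := by
  have hi := (isNuclearDecomposition_nuclearIdem e).mem_nucleus i
  have hj := (isNuclearDecomposition_nuclearIdem e).mem_nucleus j
  have h1 : (1 : Ω) ⊗ₜ[F] (biAction K (k ⊗ₜ k') a) =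
      (1 ⊗ₜ ((k : nucleus F A) : A)) * (1 ⊗ₜ a) * (1 ⊗ₜ ((k' : nucleus F A) : A)) := by
    rw [biAction_tmul, Algebra.TensorProduct.tmul_mul_tmul, Algebra.TensorProduct.tmul_mul_tmul,
      one_mul, one_mul]
  rw [h1, ← left_assoc hi, ← left_assoc hi, nuclearIdem_mul, right_assoc hj, mul_nuclearIdem,
    smul_mul_assoc, smul_mul_assoc, mul_smul_comm, smul_smul]

/-- If `A` is free of rank one over `K ⊗ K`, the idempotents of a splitting of `K` are part of a
frame. -/
theorem isFrame_of_bijective (a : A) (ha : Function.Bijective fun t => biAction K t a) :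
    IsFrame Ω (nuclearIdem e) (fun i j => nuclearIdem e i * (1 ⊗ₜ a) * nuclearIdem e j) := by
  have hd := isNuclearDecomposition_nuclearIdem e
  set u := fun i j => nuclearIdem e i * ((1 : Ω) ⊗ₜ[F] a) * nuclearIdem e j with hu
  have hspan (i j) (x : Ω ⊗[F] A) : ∃ r : Ω, nuclearIdem e i * x * nuclearIdem e j = r • u i j := by
    induction x with
    | zero => exact ⟨0, by simp⟩
    | add x y hx hy =>
      obtain ⟨r, hr⟩ := hx
      obtain ⟨s, hs⟩ := hy
      exact ⟨r + s, by rw [mul_add, add_mul, hr, hs, add_smul]⟩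
    | tmul ω y =>
      obtain ⟨t, rfl⟩ := ha.2 y
      have h1 (y : A) : ω ⊗ₜ[F] y = ω • ((1 : Ω) ⊗ₜ[F] y) := by
        rw [TensorProduct.smul_tmul', smul_eq_mul, mul_one]
      beta_reduce
      induction t with
      | zero => exact ⟨0, by simp⟩
      | add t s ht hs =>
        obtain ⟨r, hr⟩ := ht
        obtain ⟨s, hs⟩ := hs
        exact ⟨r + s, by
          rw [map_add, LinearMap.add_apply, TensorProduct.tmul_add, mul_add, add_mul, hr, hs,
            add_smul]⟩
      | tmul k k' =>
        exact ⟨ω * (e (1 ⊗ₜ k) i * e (1 ⊗ₜ k') j), by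
          rw [h1, mul_smul_comm, smul_mul_assoc, nuclearIdem_biAction, smul_smul]⟩
  let ψ : (Fin n → Fin n → Ω) →ₗ[Ω] Ω ⊗[F] A :=
    { toFun := fun m => ∑ k, ∑ l, m k l • u k l
      map_add' := fun m m' => by simp [add_smul, Finset.sum_add_distrib]
      map_smul' := fun r m => by simp [mul_smul, Finset.smul_sum] }
  have hψ : Function.Surjective ψ := by
    intro x
    choose r hr using hspan
    refine ⟨fun i j => r i j x, ?_⟩
    change ∑ k, ∑ l, r k l x • u k l = x
    simp only [← hr]
    exact (hd.peirce_sum x).symm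
  have hrank : Module.finrank Ω (Ω ⊗[F] A) = n * n := by
    rw [Module.finrank_baseChange, ← (LinearEquiv.ofBijective
      (LinearMap.applyₗ a ∘ₗ (biAction K).toLinearMap) ha).finrank_eq, Module.finrank_tensorProduct,
      finrank_of_split e]
  have hfin : Module.Finite Ω (Ω ⊗[F] A) := .of_surjective ψ hψ
  -- The generators span, and freeness of rank one gives `Ω ⊗ A` dimension `n * n`; hence they are
  -- independent, in particular nonzero.
  have hinj : Function.Injective ψ :=
    (LinearMap.injective_iff_surjective_of_finrank_eq_finrank (by
      rw [hrank]; simp [Module.finrank_pi_fintype])).2 hψ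
  refine ⟨hd, fun i j h0 => ?_, fun i j => ?_, fun i j => ?_, hspan⟩
  · have h1 : ψ (Pi.single i (Pi.single j 1)) = u i j := by
      change ∑ k, ∑ l, (Pi.single i (Pi.single j (1 : Ω)) : Fin n → Fin n → Ω) k l • u k l = u i j
      rw [Finset.sum_eq_single i, Finset.sum_eq_single j]
      · simp
      · intro l _ hl
        simp [hl]
      · simp
      · intro k _ hk
        simp [hk]
      · simp
    rw [h0] at h1
    have h2 := hinj (h1.trans (map_zero ψ).symm)
    have h3 := congrFun (congrFun h2 i) j
    simp at h3
  · rw [hu]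
    beta_reduce
    rw [← left_assoc (hd.mem_nucleus i), ← left_assoc (hd.mem_nucleus i), hd.mul_self]
  · rw [hu]
    beta_reduce
    rw [right_assoc (hd.mem_nucleus j), hd.mul_self]

end SplitIdempotents

/-! ### Descent of frames to the ground field -/

section Descent

open scoped IsMulCommutative

variable {F : Type u} [Field F] {A : Type v} [NonAssocRing A] [Module F A]
  [SMulCommClass F A A] [IsScalarTower F A A] {Ω : Type w} [Field Ω] [Algebra F Ω]

/-- A central `x` gives `1 ⊗ x = r • 1` over `Ω`; slicing by an `F`-linear retraction of `F → Ω`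
yields a scalar in `F`. -/
theorem IsFrame.isCentralAlgebra_of_baseChange [Nontrivial A] {ι : Type*} [Fintype ι]
    {e : ι → Ω ⊗[F] A} {u : ι → ι → Ω ⊗[F] A} (h : IsFrame Ω e u) : IsCentralAlgebra F A := by
  refine ⟨inferInstance, Set.Subset.antisymm ?_ ?_⟩
  · intro x hx
    have hcomm (y : Ω ⊗[F] A) : (1 ⊗ₜ x) * y = y * (1 ⊗ₜ x) := by
      induction y with
      | zero => simp
      | add y z hy hz => rw [mul_add, add_mul, hy, hz]
      | tmul ω y =>
        rw [Algebra.TensorProduct.tmul_mul_tmul, Algebra.TensorProduct.tmul_mul_tmul, one_mul,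
          mul_one, (hx.comm y).eq]
    obtain ⟨r, hr⟩ := h.exists_eq_smul_one_of_commute _ hcomm
    obtain ⟨φ, hφ⟩ := LinearMap.exists_leftInverse_of_injective (Algebra.linearMap F Ω)
      (LinearMap.ker_eq_bot.2 (algebraMap F Ω).injective)
    have hφ1 : φ 1 = 1 := by
      have := LinearMap.congr_fun hφ 1
      simpa using this
    refine ⟨φ r, ?_⟩
    have h1 := congrArg (slice φ) hr
    rw [Algebra.TensorProduct.one_def, TensorProduct.smul_tmul', smul_eq_mul, mul_one, slice_tmul,
      slice_tmul, hφ1, one_smul] at h1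
    exact h1.symm
  · rintro _ ⟨r, rfl⟩
    refine ⟨fun a => ?_, fun b c => ?_, fun b c => ?_⟩
    · rw [Commute, SemiconjBy, smul_mul_assoc, one_mul, mul_smul_comm, mul_one]
    · simp only [smul_mul_assoc, one_mul]
    · simp only [mul_smul_comm, mul_one]

variable {K : Subalgebra F (nucleus F A)} [IsMulCommutative K] {n : ℕ}

/-- On the Peirce component `(i, j)` the ring `K ⊗ K` acts through the product of the characters `i`
and `j`. No component vanishes, so an element acting as zero is killed by all these products, which
separate `K ⊗ K`. -/
theorem biAction_injective_of_isFrame (e : Ω ⊗[F] K ≃ₐ[Ω] (Fin n → Ω))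
    {v : Fin n → Fin n → Ω ⊗[F] A}
    (h : IsFrame Ω (nuclearIdem e) v) : Function.Injective (biAction K) := by
  rw [injective_iff_map_eq_zero]
  intro t ht
  let σ (i : Fin n) : K →ₗ[F] Ω := (LinearMap.proj i ∘ₗ e.toLinearMap).restrictScalars F ∘ₗ
    (TensorProduct.mk F Ω K 1)
  let Λ (i j : Fin n) : K ⊗[F] K →ₗ[F] Ω :=
    LinearMap.mul' F Ω ∘ₗ TensorProduct.map (σ i) (σ j)
  have hΛ (i j) (k k' : K) : Λ i j (k ⊗ₜ k') = e (1 ⊗ₜ k) i * e (1 ⊗ₜ k') j := rfl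
  have hact (i j) (s : K ⊗[F] K) (a : A) :
      nuclearIdem e i * (1 ⊗ₜ biAction K s a) * nuclearIdem e j =
        Λ i j s • (nuclearIdem e i * (1 ⊗ₜ a) * nuclearIdem e j) := by
    induction s with
    | zero => simp
    | add s s' hs hs' =>
      rw [map_add, LinearMap.add_apply, TensorProduct.tmul_add, mul_add, add_mul, hs, hs', map_add,
        add_smul]
    | tmul k k' => rw [nuclearIdem_biAction, hΛ]
  refine eq_zero_of_forall_char e t Λ hΛ fun i j => ?_
  by_contra hne
  have hzero (x : Ω ⊗[F] A) : nuclearIdem e i * x * nuclearIdem e j = 0 := by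
    induction x with
    | zero => simp
    | add x y hx hy => rw [mul_add, add_mul, hx, hy, add_zero]
    | tmul ω a =>
      have h1 : ω ⊗ₜ[F] a = ω • ((1 : Ω) ⊗ₜ[F] a) := by
        rw [TensorProduct.smul_tmul', smul_eq_mul, mul_one]
      have h2 := hact i j t a
      rw [ht, LinearMap.zero_apply, TensorProduct.tmul_zero, mul_zero, zero_mul] at h2
      rw [h1, mul_smul_comm, smul_mul_assoc, (smul_eq_zero.1 h2.symm).resolve_left hne, smul_zero]
  apply h.ne_zero i j
  rw [← hzero (v i j), h.left_mul, h.mul_right]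

theorem isReduced_tensorProduct_of_etale (F K : Type*) [Field F] [CommRing K] [Algebra F K]
    [Algebra.Etale F K] : IsReduced (K ⊗[F] K) := by
  have : Algebra.Etale F (K ⊗[F] K) := Algebra.Etale.comp F K (K ⊗[F] K)
  exact Algebra.FormallyUnramified.isReduced_of_field F (K ⊗[F] K)

/-- Over the reduced ring `K ⊗ K` the action is faithful, and both sides have dimension `n * n`. -/
theorem isSemiassociative_of_isFrame [Nontrivial A] (hK : Algebra.Etale F K)
    (e : Ω ⊗[F] K ≃ₐ[Ω] (Fin n → Ω)) {v : Fin n → Fin n → Ω ⊗[F] A}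
    (h : IsFrame Ω (nuclearIdem e) v) : IsSemiassociative F A := by
  have := h.finiteDimensional
  have hA : FiniteDimensional F A := Module.Finite.of_finite_tensorProduct_of_faithfullyFlat Ω
  refine ⟨hA, h.isCentralAlgebra_of_baseChange, K, inferInstance, hK, ?_⟩
  have hfK : FiniteDimensional F K := Algebra.FormallyUnramified.finite_of_free F K
  let _ : Module (K ⊗[F] K) A := Module.compHom A (biAction K).toRingHom
  have hsmul (t : K ⊗[F] K) (a : A) : t • a = biAction K t a := rfl
  have : IsScalarTower F (K ⊗[F] K) A := ⟨fun r t a => by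
    rw [hsmul, hsmul, map_smul, LinearMap.smul_apply]⟩
  have := isReduced_tensorProduct_of_etale F K
  refine isMinimallyFaithful_of_finrank_eq (F := F) ⟨fun {s t} hst => ?_⟩ ?_
  · exact biAction_injective_of_isFrame e h (LinearMap.ext hst)
  · rw [Module.finrank_tensorProduct, finrank_of_split e, ← Module.finrank_baseChange (R := Ω),
      h.finrank_eq, Fintype.card_fin]

/-- If `A` becomes a skew matrix algebra over a separably closed field, it is semiassociative. -/
theorem isSemiassociative_of_isSkewMatrixAlgebra [IsSepClosed Ω]
    (h : IsSkewMatrixAlgebra Ω (Ω ⊗[F] A)) : IsSemiassociative F A := by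
  obtain ⟨m, hm, ε, u, hframe⟩ := h.exists_isFrame
  have := hframe.finiteDimensional
  have hA : FiniteDimensional F A := Module.Finite.of_finite_tensorProduct_of_faithfullyFlat Ω
  have : Nontrivial A := by
    by_contra hnt
    rw [not_nontrivial_iff_subsingleton] at hnt
    exact hframe.e_ne_zero ⟨0, hm⟩ (Subsingleton.elim _ _)
  obtain ⟨K, hKc, hK, hmax⟩ := exists_maximal_etale F (nucleus F A)
  obtain ⟨n, ⟨e⟩⟩ := (isFiniteSplit_of_isSepClosed (F := F) K Ω).nonempty_algEquiv_fun
  have hd := isNuclearDecomposition_nuclearIdem e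
  -- The frame idempotents are pulled back to the associative algebra `Ω ⊗ N`, where idempotents can
  -- be compared.
  choose ε' hε' using fun i => exists_nucleusMap_eq (hframe.mem_nucleus i)
  have hinj := nucleusMap_injective (F := F) (A := A) (Ω := Ω)
  have hequiv (k : Fin n) : ∃ i a b, a * b = Algebra.TensorProduct.map (AlgHom.id Ω Ω) K.val
      (splitIdem e k) ∧ b * a = ε' i := by
    refine exists_equivalent_idempotent (Ω := Ω) (fun i => hinj ?_) (fun i x => ?_) ?_ ?_ ?_
    · rw [nucleusMap_mul, hε', hframe.mul_self]
    · obtain ⟨r, hr⟩ := hframe.normalize.span i i (nucleusMap F A Ω x)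
      refine ⟨r, hinj ?_⟩
      rw [if_pos rfl] at hr
      rw [nucleusMap_mul, nucleusMap_mul, hε', hr, map_smul, hε']
    · rw [← map_mul, splitIdem_mul_self]
    · have hKinj : Function.Injective (LinearMap.lTensor Ω K.val.toLinearMap) :=
        Module.Flat.lTensor_preserves_injective_linearMap _ Subtype.val_injective
      intro h0
      exact splitIdem_ne_zero e k (hKinj (h0.trans (map_zero _).symm))
    · refine exists_mul_corner_eq K hmax (splitIdem_mul_self e k) (splitIdem_ne_zero e k)
        (fun t => ⟨_, mul_splitIdem e t k⟩) ε' (hinj ?_) _ rfl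
      rw [map_sum, nucleusMap_one]
      simp_rw [hε', hframe.sum_eq]
  choose s a b hab hba using hequiv
  obtain ⟨v, hv⟩ := hframe.exists_of_equivalent hd s (fun k => nucleusMap F A Ω (a k))
    (fun k => nucleusMap F A Ω (b k)) (fun k => nucleusMap_mem _) (fun k => nucleusMap_mem _)
    (fun k => by rw [← nucleusMap_mul, hab]; rfl) (fun k => by rw [← nucleusMap_mul, hba, hε'])
  exact isSemiassociative_of_isFrame hK e hv

/-- A semiassociative algebra becomes a skew matrix algebra over every field splitting its étale
subalgebra. -/
theorem IsSemiassociative.exists_split (h : IsSemiassociative F A) :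
    ∃ (K : Type v) (_ : CommRing K) (_ : Algebra F K), Algebra.Etale F K ∧
      ∀ (Ω : Type w) [Field Ω] [Algebra F Ω], Algebra.IsFiniteSplit Ω (Ω ⊗[F] K) →
        IsSkewMatrixAlgebra Ω (Ω ⊗[F] A) := by
  obtain ⟨hA, ⟨hnt, -⟩, K, hKc, hK, hmin⟩ := h
  refine ⟨K, inferInstance, inferInstance, hK, fun Ω _ _ hs => ?_⟩
  obtain ⟨n, ⟨e⟩⟩ := hs.nonempty_algEquiv_fun
  have hfK : FiniteDimensional F K := Algebra.FormallyUnramified.finite_of_free F K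
  have := isReduced_tensorProduct_of_etale F K
  have : IsArtinianRing (K ⊗[F] K) := .of_finite F _
  obtain ⟨a, ha⟩ := @IsMinimallyFaithful.exists_bijective _ _ _ _ _ _
    (Module.compHom A (biAction K).toRingHom) hmin
  have : Nontrivial (Ω ⊗[F] A) := inferInstance
  exact (isFrame_of_bijective e a ha).isSkewMatrixAlgebra

theorem IsSemiassociative.isSkewMatrixAlgebra_of_isSepClosed [IsSepClosed Ω]
    (h : IsSemiassociative F A) : IsSkewMatrixAlgebra Ω (Ω ⊗[F] A) := by
  obtain ⟨K, _, _, hK, hs⟩ := h.exists_split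
  exact hs Ω (isFiniteSplit_of_isSepClosed (F := F) K Ω)

end Descent

/-! ### Towers of extensions and the final equivalences -/

section Towers

variable {F : Type u} [Field F] {A : Type v} [NonAssocRing A] [Module F A]
  [SMulCommClass F A A] [IsScalarTower F A A]

theorem IsSkewMatrixAlgebra.of_equiv {B B' : Type*} [NonAssocRing B] [Module F B] [NonAssocRing B']
    [Module F B'] (h : IsSkewMatrixAlgebra F B) (φ : B' ≃ₗ[F] B)
    (hφ : ∀ x y, φ (x * y) = φ x * φ y) : IsSkewMatrixAlgebra F B' := by
  obtain ⟨n, hn, c, ψ, hψ⟩ := h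
  exact ⟨n, hn, c, φ.trans ψ, fun x y => by simp [hφ, hψ]⟩

theorem IsSkewMatrixAlgebra.baseChange (Ω : Type w) [Field Ω] [Algebra F Ω]
    (h : IsSkewMatrixAlgebra F A) : IsSkewMatrixAlgebra Ω (Ω ⊗[F] A) := by
  obtain ⟨n, hn, e, u, hf⟩ := h.exists_isFrame
  have hfree (x : A) (hx : x ≠ 0) : (1 : Ω) ⊗ₜ[F] x ≠ 0 := fun h0 => hx <| by
    obtain ⟨φ, hφ⟩ := LinearMap.exists_leftInverse_of_injective (Algebra.linearMap F Ω)
      (LinearMap.ker_eq_bot.2 (algebraMap F Ω).injective)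
    have hφ1 : φ 1 = 1 := by
      have := LinearMap.congr_fun hφ 1
      simpa using this
    have := congrArg (slice φ) h0
    rwa [slice_tmul, hφ1, one_smul, map_zero] at this
  have hmul (x y : A) : ((1 : Ω) ⊗ₜ[F] x) * (1 ⊗ₜ y) = 1 ⊗ₜ (x * y) := by
    rw [Algebra.TensorProduct.tmul_mul_tmul, one_mul]
  have hframe : IsFrame Ω (fun i => (1 : Ω) ⊗ₜ[F] e i) (fun i j => 1 ⊗ₜ u i j) := by
    refine ⟨⟨fun i => one_tmul_mem_nucleus (hf.mem_nucleus i), fun i => ?_, fun i j hij => ?_, ?_⟩,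
      fun i j => hfree _ (hf.ne_zero i j), fun i j => ?_, fun i j => ?_, fun i j x => ?_⟩
    · rw [hmul, hf.mul_self]
    · rw [hmul, hf.mul_of_ne _ _ hij, TensorProduct.tmul_zero]
    · rw [← TensorProduct.tmul_sum, hf.sum_eq]; rfl
    · rw [hmul, hf.left_mul]
    · rw [hmul, hf.mul_right]
    · induction x with
      | zero => exact ⟨0, by simp⟩
      | add x y hx hy =>
        obtain ⟨r, hr⟩ := hx
        obtain ⟨s, hs⟩ := hy
        exact ⟨r + s, by rw [mul_add, add_mul, hr, hs, add_smul]⟩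
      | tmul ω x =>
        obtain ⟨r, hr⟩ := hf.span i j x
        refine ⟨ω * algebraMap F Ω r, ?_⟩
        rw [Algebra.TensorProduct.tmul_mul_tmul, Algebra.TensorProduct.tmul_mul_tmul, one_mul,
          mul_one, hr, TensorProduct.smul_tmul', smul_eq_mul, mul_one, ← TensorProduct.smul_tmul,
          Algebra.smul_def, mul_comm]
  have : Nontrivial (Ω ⊗[F] A) := ⟨_, _, hframe.e_ne_zero ⟨0, hn⟩⟩
  exact hframe.isSkewMatrixAlgebra

theorem map_mul_of_forall_one_tmul {Ω : Type*} [Field Ω] [Algebra F Ω] {D : Type*}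
    [NonAssocRing D] [Module Ω D] [SMulCommClass Ω D D] [IsScalarTower Ω D D]
    (φ : Ω ⊗[F] A →ₗ[Ω] D) (hφ : ∀ x y : A, φ (1 ⊗ₜ (x * y)) = φ (1 ⊗ₜ x) * φ (1 ⊗ₜ y))
    (x y : Ω ⊗[F] A) : φ (x * y) = φ x * φ y := by
  have h1 (ω : Ω) (a : A) : ω ⊗ₜ[F] a = ω • ((1 : Ω) ⊗ₜ[F] a) := by
    rw [TensorProduct.smul_tmul', smul_eq_mul, mul_one]
  induction x with
  | zero => simp
  | add x x' hx hx' => simp only [add_mul, map_add, hx, hx']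
  | tmul ω x =>
    induction y with
    | zero => simp
    | add y y' hy hy' => simp only [mul_add, map_add, hy, hy']
    | tmul ω' y =>
      rw [Algebra.TensorProduct.tmul_mul_tmul, h1, h1 ω x, h1 ω' y, map_smul, map_smul, map_smul,
        hφ, smul_mul_smul_comm]

theorem cancelBaseChange_one_tmul_mul (E : Type*) [Field E] [Algebra F E] (Ω : Type*) [Field Ω]
    [Algebra F Ω] [Algebra E Ω] [IsScalarTower F E Ω] (x y : E ⊗[F] A) :
    TensorProduct.AlgebraTensorModule.cancelBaseChange F E Ω Ω A (1 ⊗ₜ (x * y)) =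
      TensorProduct.AlgebraTensorModule.cancelBaseChange F E Ω Ω A (1 ⊗ₜ x) *
        TensorProduct.AlgebraTensorModule.cancelBaseChange F E Ω Ω A (1 ⊗ₜ y) := by
  induction x with
  | zero => simp
  | add x x' hx hx' => simp only [add_mul, TensorProduct.tmul_add, map_add, hx, hx']
  | tmul r a =>
    induction y with
    | zero => simp
    | add y y' hy hy' => simp only [mul_add, TensorProduct.tmul_add, map_add, hy, hy']
    | tmul s b =>
      simp only [Algebra.TensorProduct.tmul_mul_tmul,
        TensorProduct.AlgebraTensorModule.cancelBaseChange_tmul, smul_mul_smul_comm, mul_one]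

theorem cancelBaseChange_mul (E : Type*) [Field E] [Algebra F E] (Ω : Type*) [Field Ω]
    [Algebra F Ω] [Algebra E Ω] [IsScalarTower F E Ω] (x y : Ω ⊗[E] (E ⊗[F] A)) :
    TensorProduct.AlgebraTensorModule.cancelBaseChange F E Ω Ω A (x * y) =
      TensorProduct.AlgebraTensorModule.cancelBaseChange F E Ω Ω A x *
        TensorProduct.AlgebraTensorModule.cancelBaseChange F E Ω Ω A y :=
  map_mul_of_forall_one_tmul
    (TensorProduct.AlgebraTensorModule.cancelBaseChange F E Ω Ω A).toLinearMap
    (cancelBaseChange_one_tmul_mul E Ω) x y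

variable {E : Type w} [Field E] [Algebra F E]

/-- Base change in two steps is base change in one, compatibly with multiplication, so the separably
closed case applies over `F` directly. -/
theorem isSemiassociative_of_baseChange_algebraicClosure
    (h : IsSkewMatrixAlgebra (AlgebraicClosure E) (AlgebraicClosure E ⊗[E] (E ⊗[F] A))) :
    IsSemiassociative F A := by
  refine isSemiassociative_of_isSkewMatrixAlgebra (Ω := AlgebraicClosure E) (h.of_equiv
    (TensorProduct.AlgebraTensorModule.cancelBaseChange F E (AlgebraicClosure E)
      (AlgebraicClosure E) A).symm fun x y => ?_)
  rw [LinearEquiv.symm_apply_eq, cancelBaseChange_mul, LinearEquiv.apply_symm_apply,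
    LinearEquiv.apply_symm_apply]

theorem isGeometricallyReduced_of_isSeparable [FiniteDimensional F E] [Algebra.IsSeparable F E] :
    Algebra.IsGeometricallyReduced F E := by
  have : Algebra.FormallyUnramified F E := .of_isSeparable F E
  exact ⟨fun p _ => Algebra.FormallyUnramified.isReduced_of_field
    (AlgebraicClosure p.ResidueField) _⟩

/-- Semiassociativity descends along arbitrary field extensions: separability of `E / F` is not
needed, because the nuclear idempotents over the algebraic closure already split an étale
subalgebra of the nucleus of `A`. -/
theorem IsSemiassociative.of_baseChange (h : IsSemiassociative E (E ⊗[F] A)) :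
    IsSemiassociative F A :=
  isSemiassociative_of_baseChange_algebraicClosure h.isSkewMatrixAlgebra_of_isSepClosed

theorem IsSkewMatrixAlgebra.isSemiassociative_of_baseChange
    (h : IsSkewMatrixAlgebra E (E ⊗[F] A)) : IsSemiassociative F A :=
  isSemiassociative_of_baseChange_algebraicClosure (h.baseChange (AlgebraicClosure E))

/-- A semiassociative algebra becomes a skew matrix algebra over a finite separable extension. -/
theorem IsSemiassociative.exists_finite_separable (h : IsSemiassociative F A) :
    ∃ (E : Type u) (_ : Field E) (_ : Algebra F E), FiniteDimensional F E ∧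
      Algebra.IsSeparable F E ∧ IsSkewMatrixAlgebra E (E ⊗[F] A) := by
  obtain ⟨K, _, _, hK, hs⟩ := h.exists_split
  obtain ⟨E, _, _, hE, hsep, hsplit⟩ := exists_finite_separable_isFiniteSplit F K
  exact ⟨E, _, _, hE, hsep, hs E hsplit⟩

end Towers

end Semiassoc

theorem mainTheorem2 {F : Type u} [Field F] {A : Type v} [NonAssocRing A] [Module F A]
    [SMulCommClass F A A] [IsScalarTower F A A] :
    -- descent of semiassociativity along separable field extensions, algebraic or not
    (∀ (E : Type w) [Field E] [Algebra F E], Algebra.IsGeometricallyReduced F E →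
      Semiassoc.IsSemiassociative E (E ⊗[F] A) → Semiassoc.IsSemiassociative F A) ∧
    -- the semiassociative algebras are the forms of skew matrices
    (Semiassoc.IsSemiassociative F A ↔ Semiassoc.IsFormOfSkewMatrices F A) ∧
    -- the same with separable algebraic extensions, or with finite separable ones
    (Semiassoc.IsSemiassociative F A ↔
      ∃ (E : Type u) (_ : Field E) (_ : Algebra F E),
        Algebra.IsSeparable F E ∧ Semiassoc.IsSkewMatrixAlgebra E (E ⊗[F] A)) ∧
    (Semiassoc.IsSemiassociative F A ↔
      ∃ (E : Type u) (_ : Field E) (_ : Algebra F E), FiniteDimensional F E ∧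
        Algebra.IsSeparable F E ∧ Semiassoc.IsSkewMatrixAlgebra E (E ⊗[F] A)) := by
  refine ⟨fun E _ _ _ h => h.of_baseChange, ⟨fun h => ?_, ?_⟩, ⟨fun h => ?_, ?_⟩,
    ⟨fun h => h.exists_finite_separable, ?_⟩⟩
  · obtain ⟨E, _, _, _, _, h⟩ := h.exists_finite_separable
    exact ⟨E, _, _, Semiassoc.isGeometricallyReduced_of_isSeparable, h⟩
  · rintro ⟨E, _, _, _, h⟩
    exact h.isSemiassociative_of_baseChange
  · obtain ⟨E, _, _, _, hs, h⟩ := h.exists_finite_separable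
    exact ⟨E, _, _, hs, h⟩
  · rintro ⟨E, _, _, _, h⟩
    exact h.isSemiassociative_of_baseChange
  · rintro ⟨E, _, _, _, _, h⟩
    exact h.isSemiassociative_of_baseChange
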